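/- Let $\mathbf n=(n_k)_{k\ge1}$ be integers with $n_k\ge2$ and $\mathbf c=(c_k)_{k\ge1}$ reals in $(0,1)$ with $(n_k-1)c_k<1$ for all $k\geq 1$. Let $E_0=[0,1]$, and let $E_k$ be obtained from $E_{k-1}$ by deleting from every component $I$ of $E_{k-1}$ $n_k-1$ open intervals of equal length $c_k|I|$ such that the $n_k$ remaining closed intervals are of equal length. The uniform Cantor set is $E=\bigcap_{k\ge0}E_k$. Write $\delta_k=\prod_{i=1}^k\frac{1-(n_i-1)c_i}{n_i}$ for the length of a component of $E_k$ and $\varepsilon_k=c_k\delta_{k-1}$ for the length of a gap of level $k$. Let $W_k=\{i_1\cdots i_k:1\le i_j\le n_j\}$ be the set of words of length $k$ ($W_0$ contains only the empty word). For the empty word $w$ let $I_w=[0,1]$, and for $w\in W_{k-1}$ let $I_{w1},\dots,I_{wn_k}$ be the components of $E_k$ contained in $I_w$, from left to right. For a word $v$ of length $k$ let $vu_t=v\,n_{k+1}\cdots n_{k+t}$ and $v1^t=v1\cdots1$ be the maximal and the minimal word of length $k+t$ with prefix $v$. Let $\Lambda=\{k\ge1:\varepsilon_k<\delta_k\}$.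 For $k\in\Lambda$ let $m_k$ be the unique positive integer with $\delta_{k+m_k}\le\varepsilon_k<\delta_{k+m_k-1}$, and let $s_k$ be the unique positive integer with $$s_k\delta_{k+m_k}+(s_k-1)\varepsilon_{k+m_k}\le\varepsilon_k<(s_k+1)\delta_{k+m_k}+s_k\varepsilon_{k+m_k}.$$ A vector $(p_1,\dots,p_N)$ of positive numbers is called $(C,s)$-uniform if $$C^{-1}\le\frac{p_{i+1}+\cdots+p_{i+l}}{p_{j+1}+\cdots+p_{j+l}}\le C\quad\text{whenever } 0\le i\le j\le i+l\le j+l\le N\text{ and } l\ge s,$$ and $C$-uniform if it is $(C,1)$-uniform. A Borel measure $\mu$ on a metric space $X$ is doubling if there is $C\ge1$ with $0<\mu(B(x,2r))\le C\mu(B(x,r))<\infty$ for all $x\in X$ and $r>0$. Let $\mu$ be a Borel probability measure on $E$ with $\mu(I_w)>0$ for every word $w$. For $w\in W_{k-1}$, $k\ge1$, put $p_{wi}=\mu(I_{wi})/\mu(I_w)$ for $1\le i\le n_k$ and $P_w=(p_{w1},\dots,p_{wn_k})$. Then $\mu$ is doubling on $E$ if and only if there is a constant $C>1$ such that $P_w$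 is $C$-uniform for every word $w$ and, for each $k\in\Lambda$, every $w\in W_{k-1}$ and every $1\le i<n_k$, the following two conditions hold. (a) For all $1\le t<m_k$, the concatenated vector $(P_{wiu_{t-1}},P_{w(i+1)1^{t-1}})$ is $C$-uniform and $$C^{-1}\prod_{j=1}^tp_{wiu_j}\le\prod_{j=1}^tp_{w(i+1)1^j}\le C\prod_{j=1}^tp_{wiu_j}.$$ (b) The concatenated vector $(P_{wiu_{m_k-1}},P_{w(i+1)1^{m_k-1}})$ is $(C,s_k)$-uniform. -/

import Mathlib

open MeasureTheory Set
open scoped NNReal ENNReal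

noncomputable section

/-- A (Borel) measure `μ` on a metric space is doubling if there is `C ≥ 1` with
`0 < μ(B(x,2r)) ≤ C μ(B(x,r)) < ∞` for all points `x` and all `r > 0`. -/
def IsDoublingMeasure {X : Type*} [MetricSpace X] [MeasurableSpace X] (μ : Measure X) : Prop :=
  ∃ C : ℝ≥0, 1 ≤ C ∧ ∀ (x : X) (r : ℝ), 0 < r →
    0 < μ (Metric.ball x (2 * r)) ∧
    μ (Metric.ball x (2 * r)) ≤ (C : ℝ≥0∞) * μ (Metric.ball x r) ∧
    (C : ℝ≥0∞) * μ (Metric.ball x r) < ∞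

/-- The sum `p_{i+1} + ⋯ + p_{i+l}` for a vector `P = (p_1, …, p_N)`, given as the list of its
entries (so that the entry `p_{i+1}` has position `i` in the list). -/
def blockSum (P : List ℝ) (i l : ℕ) : ℝ := ∑ a ∈ Finset.range l, P.getD (i + a) 0

/-- `(C, s)`-uniformness of a vector `P = (p_1, …, p_N)` of positive numbers:
sums of `l ≥ s` consecutive entries over adjacent or overlapping blocks are `C`-comparable. -/
def IsUniformFrom (C : ℝ) (s : ℕ) (P : List ℝ) : Prop :=
  ∀ i j l : ℕ, s ≤ l → i ≤ j → j ≤ i + l → j + l ≤ P.length →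
    C⁻¹ ≤ blockSum P i l / blockSum P j l ∧ blockSum P i l / blockSum P j l ≤ C

/-- `C`-uniformness, which is `(C, 1)`-uniformness. -/
def IsUniform (C : ℝ) (P : List ℝ) : Prop := IsUniformFrom C 1 P

namespace UniformCantor

/-! The sequences `n_1, n_2, …` and `c_1, c_2, …` are functions on `ℕ` whose value at `0` is
never used. -/

/-- The length `δ_k` of a component of level `k`; in particular `δ_0 = 1`. -/
def compLen (n : ℕ → ℕ) (c : ℕ → ℝ) (k : ℕ) : ℝ :=
  ∏ i ∈ Finset.Icc 1 k, (1 - ((n i : ℝ) - 1) * c i) / (n i : ℝ)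

/-- The length `ε_k = c_k δ_{k-1}` of a gap of level `k ≥ 1`. -/
def gapLen (n : ℕ → ℕ) (c : ℕ → ℝ) (k : ℕ) : ℝ := c k * compLen n c (k - 1)

/-- `w = i_1 i_2 ⋯ i_k` is a word (an element of `W_k`, where `k` is the length of `w`) if
`1 ≤ i_j ≤ n_j` for `1 ≤ j ≤ k`. The empty word is the only element of `W_0`. -/
def IsWord (n : ℕ → ℕ) (w : List ℕ) : Prop :=
  ∀ j < w.length, 1 ≤ w.getD j 0 ∧ w.getD j 0 ≤ n (j + 1)

/-- The left endpoint of the component labelled by the word `w`: the left endpoint of the `i`-th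
component of level `k` inside a component `I` of level `k - 1` is at distance
`(i - 1) (δ_k + ε_k)` from the left endpoint of `I`. -/
def leftEnd (n : ℕ → ℕ) (c : ℕ → ℝ) (w : List ℕ) : ℝ :=
  ∑ j ∈ Finset.range w.length,
    ((w.getD j 0 : ℝ) - 1) * (compLen n c (j + 1) + gapLen n c (j + 1))

/-- The component `I_w`, a closed interval of length `δ_k` where `k` is the length of `w`.
For the empty word it is `[0, 1]`. -/
def component (n : ℕ → ℕ) (c : ℕ → ℝ) (w : List ℕ) : Set ℝ :=
  Icc (leftEnd n c w) (leftEnd n c w + compLen n c w.length)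

/-- The set `E_k`, the union of the components of level `k`. -/
def levelSet (n : ℕ → ℕ) (c : ℕ → ℝ) (k : ℕ) : Set ℝ :=
  ⋃ w ∈ {w : List ℕ | IsWord n w ∧ w.length = k}, component n c w

/-- The uniform Cantor set `E(n, c) = ⋂_k E_k`. -/
def cantorSet (n : ℕ → ℕ) (c : ℕ → ℝ) : Set ℝ := ⋂ k, levelSet n c k

/-- The set `Λ` of the levels at which gaps are shorter than components. -/
def shortGapLevels (n : ℕ → ℕ) (c : ℕ → ℝ) : Set ℕ :=
  {k | 1 ≤ k ∧ gapLen n c k < compLen n c k}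

/-- `m` is a positive integer with `δ_{k+m} ≤ ε_k < δ_{k+m-1}`. -/
def IsGapDepth (n : ℕ → ℕ) (c : ℕ → ℝ) (k m : ℕ) : Prop :=
  1 ≤ m ∧ compLen n c (k + m) ≤ gapLen n c k ∧ gapLen n c k < compLen n c (k + m - 1)

/-- The integer `m_k`, for `k ∈ Λ`: the unique `m` with `IsGapDepth n c k m`
(see `existsUnique_isGapDepth`). -/
def gapDepth (n : ℕ → ℕ) (c : ℕ → ℝ) (k : ℕ) : ℕ := sInf {m | IsGapDepth n c k m}

/-- `s` is a positive integer with
`s δ_{k+m_k} + (s - 1) ε_{k+m_k} ≤ ε_k < (s + 1) δ_{k+m_k} + s ε_{k+m_k}`. -/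
def IsGapCount (n : ℕ → ℕ) (c : ℕ → ℝ) (k s : ℕ) : Prop :=
  1 ≤ s ∧
  (s : ℝ) * compLen n c (k + gapDepth n c k)
      + ((s : ℝ) - 1) * gapLen n c (k + gapDepth n c k) ≤ gapLen n c k ∧
  gapLen n c k < ((s : ℝ) + 1) * compLen n c (k + gapDepth n c k)
      + (s : ℝ) * gapLen n c (k + gapDepth n c k)

/-- The integer `s_k`, for `k ∈ Λ`: the unique `s` with `IsGapCount n c k s`
(see `existsUnique_isGapCount`). -/
def gapCount (n : ℕ → ℕ) (c : ℕ → ℝ) (k : ℕ) : ℕ := sInf {s | IsGapCount n c k s}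

/-- The word `v u_t`, for a word `v`: the maximal word with prefix `v` that is longer by `t`. -/
def maxExt (n : ℕ → ℕ) (v : List ℕ) (t : ℕ) : List ℕ :=
  v ++ (List.range t).map (fun j => n (v.length + 1 + j))

/-- The word `v 1^t`, for a word `v`: the minimal word with prefix `v` that is longer by `t`. -/
def minExt (v : List ℕ) (t : ℕ) : List ℕ := v ++ List.replicate t 1

section Ratios

variable {n : ℕ → ℕ} {c : ℕ → ℝ}

/-- The number `μ(I_w)`, for a finite measure `μ` on the Cantor set. -/
def mass (μ : Measure (cantorSet n c)) (w : List ℕ) : ℝ :=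
  μ.real {x : cantorSet n c | (x : ℝ) ∈ component n c w}

/-- The conditional ratio `p_{wi} = μ(I_{wi}) / μ(I_w)`, as a function of the nonempty word
`wi`. -/
def ratio (μ : Measure (cantorSet n c)) (v : List ℕ) : ℝ := mass μ v / mass μ v.dropLast

/-- The vector `P_w = (p_{w1}, …, p_{w n_k})`, for a word `w` of length `k - 1`. -/
def ratioVec (μ : Measure (cantorSet n c)) (w : List ℕ) : List ℝ :=
  (List.range (n (w.length + 1))).map (fun a => ratio μ (w ++ [a + 1]))

end Ratios

/-! The integers `m_k` and `s_k` exist and are unique. -/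

lemma compLen_pos {n : ℕ → ℕ} {c : ℕ → ℝ} (hn : ∀ k, 1 ≤ k → 2 ≤ n k)
    (hnc : ∀ k, 1 ≤ k → ((n k : ℝ) - 1) * c k < 1) (k : ℕ) : 0 < compLen n c k := by
  refine Finset.prod_pos fun i hi => ?_
  have h1 : 1 ≤ i := (Finset.mem_Icc.1 hi).1
  have h2 : (2 : ℝ) ≤ n i := by exact_mod_cast hn i h1
  exact div_pos (by linarith [hnc i h1]) (by linarith)

lemma compLen_succ_le {n : ℕ → ℕ} {c : ℕ → ℝ} (hn : ∀ k, 1 ≤ k → 2 ≤ n k)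
    (hc : ∀ k, 1 ≤ k → 0 < c k ∧ c k < 1)
    (hnc : ∀ k, 1 ≤ k → ((n k : ℝ) - 1) * c k < 1) (k : ℕ) :
    compLen n c (k + 1) ≤ compLen n c k * (1 / 2) := by
  have h1 : 1 ≤ k + 1 := by omega
  have h2 : (2 : ℝ) ≤ n (k + 1) := by exact_mod_cast hn _ h1
  have h3 := (hc _ h1).1
  unfold compLen
  rw [Finset.prod_Icc_succ_top h1]
  refine mul_le_mul_of_nonneg_left ?_ (compLen_pos hn hnc k).le
  rw [div_le_div_iff₀ (by linarith) (by norm_num)]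
  nlinarith

lemma compLen_lt {n : ℕ → ℕ} {c : ℕ → ℝ} (hn : ∀ k, 1 ≤ k → 2 ≤ n k)
    (hc : ∀ k, 1 ≤ k → 0 < c k ∧ c k < 1)
    (hnc : ∀ k, 1 ≤ k → ((n k : ℝ) - 1) * c k < 1) : StrictAnti (compLen n c) :=
  strictAnti_nat_of_succ_lt fun k => by
    linarith [compLen_succ_le hn hc hnc k, compLen_pos hn hnc k]

lemma existsUnique_isGapDepth {n : ℕ → ℕ} {c : ℕ → ℝ} (hn : ∀ k, 1 ≤ k → 2 ≤ n k)
    (hc : ∀ k, 1 ≤ k → 0 < c k ∧ c k < 1)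
    (hnc : ∀ k, 1 ≤ k → ((n k : ℝ) - 1) * c k < 1) {k : ℕ} (hk : k ∈ shortGapLevels n c) :
    (∃! m, IsGapDepth n c k m) ∧ IsGapDepth n c k (gapDepth n c k) := by
  have hanti := compLen_lt hn hc hnc
  have hpos : 0 < gapLen n c k := mul_pos (hc k hk.1).1 (compLen_pos hn hnc _)
  have hgeo : ∀ m, compLen n c (k + m) ≤ compLen n c k * (1 / 2) ^ m := by
    intro m
    induction m with
    | zero => simp
    | succ m ih =>
      have := compLen_succ_le hn hc hnc (k + m)
      rw [pow_succ, ← add_assoc]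
      linarith
  have hex : ∃ m, compLen n c (k + m) ≤ gapLen n c k := by
    obtain ⟨m, hm⟩ := exists_pow_lt_of_lt_one (div_pos hpos (compLen_pos hn hnc k))
      (by norm_num : (1 / 2 : ℝ) < 1)
    refine ⟨m, (hgeo m).trans ?_⟩
    rw [lt_div_iff₀ (compLen_pos hn hnc k)] at hm
    linarith
  have hE : ∃ m, IsGapDepth n c k m := by
    classical
    have h0 : Nat.find hex ≠ 0 := by
      intro h
      have := Nat.find_spec hex
      rw [h] at this
      exact absurd hk.2 (not_lt.2 this)
    refine ⟨Nat.find hex, by omega, Nat.find_spec hex, ?_⟩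
    have := Nat.find_min hex (m := Nat.find hex - 1) (by omega)
    rw [not_le] at this
    rwa [Nat.add_sub_assoc (by omega)]
  have hle : ∀ a b, IsGapDepth n c k a → IsGapDepth n c k b → a ≤ b := by
    intro a b ha hb
    have h := hanti.lt_iff_gt.1 (hb.2.1.trans_lt ha.2.2)
    have := ha.1
    omega
  obtain ⟨m, hm⟩ := hE
  exact ⟨⟨m, hm, fun b hb => le_antisymm (hle _ _ hb hm) (hle _ _ hm hb)⟩,
    Nat.sInf_mem (s := {m | IsGapDepth n c k m}) ⟨m, hm⟩⟩

lemma existsUnique_isGapCount {n : ℕ → ℕ} {c : ℕ → ℝ} (hn : ∀ k, 1 ≤ k → 2 ≤ n k)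
    (hc : ∀ k, 1 ≤ k → 0 < c k ∧ c k < 1)
    (hnc : ∀ k, 1 ≤ k → ((n k : ℝ) - 1) * c k < 1) {k : ℕ} (hk : k ∈ shortGapLevels n c) :
    (∃! s, IsGapCount n c k s) ∧ IsGapCount n c k (gapCount n c k) := by
  obtain ⟨hm1, hm2, -⟩ := (existsUnique_isGapDepth hn hc hnc hk).2
  set K := k + gapDepth n c k with hK
  have hd : 0 < compLen n c K := compLen_pos hn hnc K
  have hg : 0 < gapLen n c K := mul_pos (hc K (by omega)).1 (compLen_pos hn hnc _)
  have hs : 0 < compLen n c K + gapLen n c K := by linarith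
  have hf1 : (⌊(gapLen n c k + gapLen n c K) / (compLen n c K + gapLen n c K)⌋₊ : ℝ)
      ≤ (gapLen n c k + gapLen n c K) / (compLen n c K + gapLen n c K) :=
    Nat.floor_le (div_nonneg (by linarith) hs.le)
  have hf2 := Nat.lt_floor_add_one
    ((gapLen n c k + gapLen n c K) / (compLen n c K + gapLen n c K))
  rw [le_div_iff₀ hs] at hf1
  rw [div_lt_iff₀ hs] at hf2
  have hE : ∃ s, IsGapCount n c k s := by
    refine ⟨⌊(gapLen n c k + gapLen n c K) / (compLen n c K + gapLen n c K)⌋₊, ?_, ?_, ?_⟩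
    · rw [Nat.le_floor_iff' one_ne_zero, le_div_iff₀ hs]
      push_cast
      linarith
    · rw [← hK]; linarith
    · rw [← hK]; linarith
  have hle : ∀ a b, IsGapCount n c k a → IsGapCount n c k b → a ≤ b := by
    intro a b ha hb
    have h := ha.2.1.trans_lt hb.2.2
    rw [← hK] at h
    have h' : (a : ℝ) * (compLen n c K + gapLen n c K)
        < ((b : ℝ) + 1) * (compLen n c K + gapLen n c K) := by linarith
    have h2 : (a : ℝ) < (b : ℝ) + 1 := lt_of_mul_lt_mul_right h' hs.le
    have h3 : a < b + 1 := by exact_mod_cast h2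
    omega
  obtain ⟨s, hs'⟩ := hE
  exact ⟨⟨s, hs', fun b hb => le_antisymm (hle _ _ hb hs') (hle _ _ hs' hb)⟩,
    Nat.sInf_mem (s := {s | IsGapCount n c k s}) ⟨s, hs'⟩⟩

end UniformCantor

end

noncomputable section

namespace UniformCantor

/-! The components of each level are numbered by integers from left to right, so that a block of
consecutive components has mass `cumMass b - cumMass a`. Both doubling and uniformity then become
comparisons between neighbouring blocks of equally many components. Siblings are separated by a gap
of their own level. The last child of one component and the first child of the next are separated by
an inherited gap ε_k of an earlier level k, and such pairs are exactly the pairs wiu_t, w(i+1)1^t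
(`gapAfter_maxExt`, `Admissible.exists_maxExt`).

Doubling implies the ratio conditions. The key is `ball_step_le`: a component carries a fixed part
of the mass of a ball whose radius is a multiple of δ + ε for its level. To see this, one finds a
ball centred in the component whose mass is bounded by that of the component
(`exists_ball_gapLen_le`, `exists_ball_compLen_le`) and doubles its radius boundedly often.
Consequently l consecutive siblings control balls of radius about l steps, and neighbouring blocks
of length l are comparable when an inherited gap among them is at most about l steps
(`sibling_block_le`, `cousin_block_le`). The integers m_k and s_k say when this happens: at level k
+ t with t < m_k one component is longer than ε_k, and at level k + m_k blocks of s_k components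
suffice. At deeper levels the parents are no longer than the gap and no condition is needed.

The ratio conditions imply doubling. The two halves of a concatenated vector are normalised by
different masses. These masses are comparable because the products of ratios telescope, so
`RatioCondition.isBalanced` recovers comparisons of the masses of blocks. If δ_{k+1} < r ≤ δ_k, the
ball B(x, r) contains a block of siblings of length about r. Boundedly many doublings of this block,
and the crossing of at most two gaps, cover [x, x + 2r) (`right_half_le`). The left half follows
from the reflection x ↦ 1 - x, which preserves all hypotheses. -/

/-- The standing assumptions on the sequences `n` and `c`. -/
structure Admissible (n : ℕ → ℕ) (c : ℕ → ℝ) : Prop where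
  two_le : ∀ k, 1 ≤ k → 2 ≤ n k
  c_mem : ∀ k, 1 ≤ k → 0 < c k ∧ c k < 1
  lt_one : ∀ k, 1 ≤ k → ((n k : ℝ) - 1) * c k < 1

/-! ### Geometry of components and gaps, indexed by integers -/

/-- The distance of the left endpoints of neighbouring siblings of level `k`. -/
def step (n : ℕ → ℕ) (c : ℕ → ℝ) (k : ℕ) : ℝ := compLen n c k + gapLen n c k

/-- The number of components of level `k`. -/
def numComp (n : ℕ → ℕ) (k : ℕ) : ℤ := ∏ i ∈ Finset.Icc 1 k, (n i : ℤ)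

/-- The left endpoint of the component of level `k` with index `a`, where the components are
indexed from left to right by `0, …, numComp n k - 1`. Indices out of this range describe the
components of the translates of the Cantor set by even integers. -/
def compPos (n : ℕ → ℕ) (c : ℕ → ℝ) : ℕ → ℤ → ℝ
  -- The translates of [0, 1] are at distance 1, so every component has a neighbour on each side and
  -- the lemmas on gaps need no boundary cases.
  | 0, a => 2 * a
  | k + 1, a => compPos n c k (a / (n (k + 1) : ℤ)) +
      ((a % (n (k + 1) : ℤ) : ℤ) : ℝ) * step n c (k + 1)

/-- The length of the gap between the components of level `k` with indices `a` and `a + 1`. -/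
def gapAfter (n : ℕ → ℕ) (c : ℕ → ℝ) (k : ℕ) (a : ℤ) : ℝ :=
  compPos n c k (a + 1) - compPos n c k a - compLen n c k

variable {n : ℕ → ℕ} {c : ℕ → ℝ}

@[simp] lemma compLen_zero : compLen n c 0 = 1 := by simp [compLen]

@[simp] lemma numComp_zero : numComp n 0 = 1 := by simp [numComp]

lemma numComp_succ (k : ℕ) : numComp n (k + 1) = numComp n k * n (k + 1) := by
  unfold numComp
  rw [Finset.prod_Icc_succ_top (by omega)]

namespace Admissible

lemma two_le_int (h : Admissible n c) (k : ℕ) : (2 : ℤ) ≤ n (k + 1) := by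
  exact_mod_cast h.two_le (k + 1) (by omega)

lemma two_le_real (h : Admissible n c) (k : ℕ) : (2 : ℝ) ≤ n (k + 1) := by
  exact_mod_cast h.two_le (k + 1) (by omega)

lemma compLen_pos (h : Admissible n c) (k : ℕ) : 0 < compLen n c k :=
  UniformCantor.compLen_pos h.two_le h.lt_one k

lemma gapLen_pos (h : Admissible n c) {k : ℕ} (hk : 1 ≤ k) : 0 < gapLen n c k :=
  mul_pos (h.c_mem k hk).1 (h.compLen_pos _)

lemma step_pos (h : Admissible n c) {k : ℕ} (hk : 1 ≤ k) : 0 < step n c k :=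
  add_pos (h.compLen_pos k) (h.gapLen_pos hk)

lemma compLen_anti (h : Admissible n c) : StrictAnti (compLen n c) :=
  compLen_lt h.two_le h.c_mem h.lt_one

lemma two_mul_compLen_succ_le (h : Admissible n c) (k : ℕ) :
    2 * compLen n c (k + 1) ≤ compLen n c k := by
  linarith [compLen_succ_le h.two_le h.c_mem h.lt_one k]

lemma compLen_lt_step (h : Admissible n c) (k : ℕ) : compLen n c (k + 1) < step n c (k + 1) := by
  have := h.gapLen_pos (k := k + 1) (by omega)
  unfold step; linarith

/-- The children and the gaps between them fill the parent; every child but the last contributes a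
full step. -/
lemma compLen_eq (h : Admissible n c) (k : ℕ) :
    compLen n c k = ((n (k + 1) : ℝ) - 1) * step n c (k + 1) + compLen n c (k + 1) := by
  have h2 := h.two_le_real k
  have h1 : compLen n c (k + 1) * n (k + 1) =
      compLen n c k * (1 - ((n (k + 1) : ℝ) - 1) * c (k + 1)) := by
    unfold compLen
    rw [Finset.prod_Icc_succ_top (by omega)]
    field_simp
  have h3 : gapLen n c (k + 1) = c (k + 1) * compLen n c k := rfl
  unfold step
  rw [h3]
  linarith

lemma compLen_tendsto (h : Admissible n c) :
    Filter.Tendsto (compLen n c) Filter.atTop (nhds 0) := by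
  have hg : ∀ k, compLen n c k ≤ (1 / 2 : ℝ) ^ k := by
    intro k
    induction k with
    | zero => simp
    | succ k ih =>
      have := h.two_mul_compLen_succ_le k
      rw [pow_succ]; linarith
  exact squeeze_zero (fun k => (h.compLen_pos k).le) hg
    (tendsto_pow_atTop_nhds_zero_of_lt_one (by norm_num) (by norm_num))

lemma compPos_child (_h : Admissible n c) (k : ℕ) (e i : ℤ) (hi : 0 ≤ i) (hin : i < n (k + 1)) :
    compPos n c (k + 1) (e * n (k + 1) + i) = compPos n c k e + i * step n c (k + 1) := by
  have h1 : (e * n (k + 1) + i) / (n (k + 1) : ℤ) = e := by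
    rw [Int.add_comm, Int.add_mul_ediv_right _ _ (by omega), Int.ediv_eq_zero_of_lt hi hin,
      zero_add]
  have h2 : (e * n (k + 1) + i) % (n (k + 1) : ℤ) = i := by
    rw [Int.add_comm, Int.add_mul_emod_self_right, Int.emod_eq_of_lt hi hin]
  simp only [compPos, h1, h2]

lemma compPos_mul (h : Admissible n c) (k : ℕ) (e : ℤ) :
    compPos n c (k + 1) (e * n (k + 1)) = compPos n c k e := by
  have h2 := h.two_le_int k
  have := h.compPos_child k e 0 le_rfl (by omega)
  simpa using this

lemma exists_child (h : Admissible n c) (k : ℕ) (a : ℤ) :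
    ∃ e i : ℤ, 0 ≤ i ∧ i < n (k + 1) ∧ a = e * n (k + 1) + i := by
  have h2 := h.two_le_int k
  refine ⟨a / n (k + 1), a % n (k + 1), Int.emod_nonneg _ (by omega), Int.emod_lt_of_pos _ (by omega),
    ?_⟩
  have := Int.mul_ediv_add_emod a (n (k + 1))
  linarith

lemma child_mem_range (h : Admissible n c) {k : ℕ} {e i : ℤ} (hi : 0 ≤ i) (hin : i < n (k + 1)) :
    (0 ≤ e * n (k + 1) + i ∧ e * n (k + 1) + i < numComp n (k + 1)) ↔
      (0 ≤ e ∧ e < numComp n k) := by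
  have h2 := h.two_le_int k
  rw [numComp_succ]
  constructor
  · rintro ⟨h3, h4⟩
    constructor
    · by_contra hc
      nlinarith
    · by_contra hc
      nlinarith
  · rintro ⟨h3, h4⟩
    constructor
    · positivity
    · nlinarith

lemma compPos_succ (_h : Admissible n c) (k : ℕ) (a : ℤ) :
    compPos n c k (a + 1) = compPos n c k a + compLen n c k + gapAfter n c k a := by
  unfold gapAfter; ring

lemma gapAfter_sibling (h : Admissible n c) (k : ℕ) (e i : ℤ) (hi : 0 ≤ i)
    (hin : i + 1 < n (k + 1)) :
    gapAfter n c (k + 1) (e * n (k + 1) + i) = gapLen n c (k + 1) := by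
  unfold gapAfter
  rw [add_assoc, h.compPos_child k e (i + 1) (by omega) hin,
    h.compPos_child k e i hi (by omega)]
  unfold step
  push_cast
  ring

/-- First and last children share an endpoint with their parents. Hence a gap, once created between
siblings, is inherited unchanged by all deeper levels. -/
lemma gapAfter_last (h : Admissible n c) (k : ℕ) (e : ℤ) :
    gapAfter n c (k + 1) (e * n (k + 1) + (n (k + 1) - 1)) = gapAfter n c k e := by
  have h2 := h.two_le_int k
  unfold gapAfter
  have h1 : e * (n (k + 1) : ℤ) + (n (k + 1) - 1) + 1 = (e + 1) * n (k + 1) := by ring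
  rw [h1, h.compPos_mul, h.compPos_child k e _ (by omega) (by omega), h.compLen_eq k]
  push_cast
  ring

lemma gapAfter_zero (_h : Admissible n c) (a : ℤ) : gapAfter n c 0 a = 1 := by
  simp only [gapAfter, compPos, compLen_zero]
  push_cast
  ring

lemma gapAfter_pos (h : Admissible n c) (k : ℕ) (a : ℤ) : 0 < gapAfter n c k a := by
  induction k generalizing a with
  | zero => rw [h.gapAfter_zero]; norm_num
  | succ k ih =>
    obtain ⟨e, i, hi, hin, rfl⟩ := h.exists_child k a
    by_cases hl : i + 1 < n (k + 1)
    · rw [h.gapAfter_sibling k e i hi hl]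
      exact h.gapLen_pos (by omega)
    · have : i = n (k + 1) - 1 := by omega
      rw [this, h.gapAfter_last]
      exact ih e

lemma compPos_strictMono (h : Admissible n c) (k : ℕ) : StrictMono (compPos n c k) := by
  refine strictMono_int_of_lt_succ fun a => ?_
  rw [h.compPos_succ]
  linarith [h.compLen_pos k, h.gapAfter_pos k a]

/-- At least one of any two consecutive gaps has the length of a gap between siblings. -/
lemma gapAfter_or (h : Admissible n c) (k : ℕ) (a : ℤ) :
    gapAfter n c (k + 1) a = gapLen n c (k + 1) ∨
      (gapAfter n c (k + 1) (a + 1) = gapLen n c (k + 1) ∧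
        gapAfter n c (k + 1) (a - 1) = gapLen n c (k + 1)) := by
  have h2 := h.two_le_int k
  obtain ⟨e, i, hi, hin, rfl⟩ := h.exists_child k a
  by_cases hl : i + 1 < n (k + 1)
  · exact Or.inl (h.gapAfter_sibling k e i hi hl)
  · have hi' : i = n (k + 1) - 1 := by omega
    right
    constructor
    · have := h.gapAfter_sibling k (e + 1) 0 le_rfl (by omega)
      rw [← this]
      congr 1
      rw [hi']; ring
    · have := h.gapAfter_sibling k e (i - 1) (by omega) (by omega)
      rw [← this]
      congr 1
      ring

lemma compPos_add_compLen_lt (h : Admissible n c) {k : ℕ} {a b : ℤ} (hab : a < b) :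
    compPos n c k a + compLen n c k < compPos n c k b := by
  have h1 := (h.compPos_strictMono k).monotone (show a + 1 ≤ b by omega)
  rw [h.compPos_succ] at h1
  linarith [h.gapAfter_pos k a]

lemma index_le (h : Admissible n c) {k : ℕ} {a b : ℤ} {x y : ℝ} (hxy : x ≤ y)
    (ha : compPos n c k a ≤ x) (hb : y ≤ compPos n c k b + compLen n c k) : a ≤ b := by
  by_contra hc
  have := h.compPos_add_compLen_lt (k := k) (show b < a by omega)
  linarith

lemma component_subset_parent (h : Admissible n c) {k : ℕ} {e i : ℤ} (hi : 0 ≤ i)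
    (hin : i < n (k + 1)) {x : ℝ} (hx : compPos n c (k + 1) (e * n (k + 1) + i) ≤ x)
    (hx' : x ≤ compPos n c (k + 1) (e * n (k + 1) + i) + compLen n c (k + 1)) :
    compPos n c k e ≤ x ∧ x ≤ compPos n c k e + compLen n c k := by
  rw [h.compPos_child k e i hi hin] at hx hx'
  have h1 := h.step_pos (k := k + 1) (by omega)
  have h2 : (0 : ℝ) ≤ i := by exact_mod_cast hi
  have h3 : (i : ℝ) ≤ (n (k + 1) : ℝ) - 1 := by
    have : i ≤ n (k + 1) - 1 := by omega
    exact_mod_cast this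
  rw [h.compLen_eq k]
  constructor <;> nlinarith

end Admissible

/-! ### The Cantor set, its endpoints and its reflection symmetry -/

/-- The points of the Cantor set, in terms of the indices of components. -/
def cantorPoints (n : ℕ → ℕ) (c : ℕ → ℝ) : Set ℝ :=
  {x | ∀ k, ∃ a, 0 ≤ a ∧ a < numComp n k ∧ compPos n c k a ≤ x ∧
    x ≤ compPos n c k a + compLen n c k}

namespace Admissible

/-- Components are nested, so membership passes from a level to all coarser ones. -/
lemma mem_cantorPoints_of_frequently (h : Admissible n c) {x : ℝ}
    (hx : ∀ k, ∃ j ≥ k, ∃ a, 0 ≤ a ∧ a < numComp n j ∧ compPos n c j a ≤ x ∧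
      x ≤ compPos n c j a + compLen n c j) : x ∈ cantorPoints n c := by
  intro k
  obtain ⟨j, hj, hx⟩ := hx k
  obtain ⟨t, rfl⟩ := Nat.exists_eq_add_of_le hj
  clear hj
  induction t with
  | zero => exact hx
  | succ t ih =>
    obtain ⟨a, h0, h1, h2, h3⟩ := hx
    obtain ⟨e, i, hi, hin, rfl⟩ := h.exists_child (k + t) a
    have h4 := (h.child_mem_range hi hin).1 ⟨h0, h1⟩
    have h5 := h.component_subset_parent hi hin h2 h3
    exact ih ⟨e, h4.1, h4.2, h5.1, h5.2⟩

/-- A left endpoint stays the left endpoint of a first child at every deeper level. Endpoints are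
the centres at which the doubling condition is applied. -/
lemma compPos_mem (h : Admissible n c) {k : ℕ} {a : ℤ} (h0 : 0 ≤ a) (h1 : a < numComp n k) :
    compPos n c k a ∈ cantorPoints n c := by
  have key : ∀ t, ∃ b, 0 ≤ b ∧ b < numComp n (k + t) ∧ compPos n c (k + t) b = compPos n c k a := by
    intro t
    induction t with
    | zero => exact ⟨a, h0, h1, rfl⟩
    | succ t ih =>
      obtain ⟨b, hb0, hb1, hb⟩ := ih
      have h2 := h.two_le_int (k + t)
      have := (h.child_mem_range (k := k + t) (e := b) (i := 0) le_rfl (by omega)).2 ⟨hb0, hb1⟩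
      simp only [add_zero] at this
      exact ⟨b * n (k + t + 1), this.1, this.2, by rw [← hb]; exact h.compPos_mul (k + t) b⟩
  refine h.mem_cantorPoints_of_frequently fun j => ?_
  obtain ⟨b, hb0, hb1, hb⟩ := key j
  exact ⟨k + j, by omega, b, hb0, hb1, hb.le, by rw [hb]; linarith [h.compLen_pos (k + j)]⟩

lemma compPos_add_mem (h : Admissible n c) {k : ℕ} {a : ℤ} (h0 : 0 ≤ a)
    (h1 : a < numComp n k) : compPos n c k a + compLen n c k ∈ cantorPoints n c := by
  have key : ∀ t, ∃ b, 0 ≤ b ∧ b < numComp n (k + t) ∧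
      compPos n c (k + t) b + compLen n c (k + t) = compPos n c k a + compLen n c k := by
    intro t
    induction t with
    | zero => exact ⟨a, h0, h1, rfl⟩
    | succ t ih =>
      obtain ⟨b, hb0, hb1, hb⟩ := ih
      have h2 := h.two_le_int (k + t)
      have := (h.child_mem_range (k := k + t) (e := b) (i := n (k + t + 1) - 1) (by omega)
        (by omega)).2 ⟨hb0, hb1⟩
      refine ⟨_, this.1, this.2, ?_⟩
      rw [← hb, ← add_assoc, h.compPos_child (k + t) b _ (by omega) (by omega),
        h.compLen_eq (k + t)]
      push_cast
      ring
  refine h.mem_cantorPoints_of_frequently fun j => ?_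
  obtain ⟨b, hb0, hb1, hb⟩ := key j
  exact ⟨k + j, by omega, b, hb0, hb1, by rw [← hb]; linarith [h.compLen_pos (k + j)], hb.ge⟩

/-- A point of the Cantor set in a component lies in one of its children. -/
lemma exists_child_of_mem (h : Admissible n c) {k : ℕ} {e : ℤ} {x : ℝ}
    (hx : x ∈ cantorPoints n c) (h1 : compPos n c k e ≤ x)
    (h2 : x ≤ compPos n c k e + compLen n c k) :
    ∃ i : ℤ, 0 ≤ i ∧ i < n (k + 1) ∧ compPos n c k e + i * step n c (k + 1) ≤ x ∧
      x ≤ compPos n c k e + i * step n c (k + 1) + compLen n c (k + 1) := by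
  obtain ⟨a, -, -, h3, h4⟩ := hx (k + 1)
  obtain ⟨e', i, hi, hin, rfl⟩ := h.exists_child k a
  have h5 := h.component_subset_parent hi hin h3 h4
  have h6 : e = e' := le_antisymm (h.index_le le_rfl h1 h5.2) (h.index_le le_rfl h5.1 h2)
  subst h6
  rw [h.compPos_child k e i hi hin] at h3 h4
  exact ⟨i, hi, hin, h3, h4⟩

/-- The reflection `x ↦ 1 - x` reverses the order of the components. -/
lemma one_sub_compPos (h : Admissible n c) (k : ℕ) (a : ℤ) :
    1 - compPos n c k a = compPos n c k (numComp n k - 1 - a) + compLen n c k := by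
  induction k generalizing a with
  | zero =>
    simp only [compPos, numComp_zero, compLen_zero]
    push_cast
    ring
  | succ k ih =>
    obtain ⟨e, i, hi, hin, rfl⟩ := h.exists_child k a
    have h1 : numComp n (k + 1) - 1 - (e * n (k + 1) + i) =
      (numComp n k - 1 - e) * n (k + 1) + (n (k + 1) - 1 - i) := by
      rw [numComp_succ]; ring
    rw [h1, h.compPos_child k e i hi hin, h.compPos_child k _ _ (by omega) (by omega)]
    have h2 := ih e
    rw [h.compLen_eq k] at h2
    push_cast
    linarith

lemma one_sub_mem (h : Admissible n c) {x : ℝ} (hx : x ∈ cantorPoints n c) :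
    1 - x ∈ cantorPoints n c := by
  intro k
  obtain ⟨a, h0, h1, h2, h3⟩ := hx k
  have := h.one_sub_compPos k a
  exact ⟨numComp n k - 1 - a, by omega, by omega, by linarith, by linarith⟩

lemma gapAfter_reflect (h : Admissible n c) (k : ℕ) (a : ℤ) :
    gapAfter n c k (numComp n k - 2 - a) = gapAfter n c k a := by
  have h1 := h.one_sub_compPos k a
  have h2 := h.one_sub_compPos k (a + 1)
  have h3 : numComp n k - 1 - (a + 1) = numComp n k - 2 - a := by ring
  have h4 : numComp n k - 2 - a + 1 = numComp n k - 1 - a := by ring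
  rw [h3] at h2
  unfold gapAfter
  rw [h4]
  linarith

end Admissible

/-! ### Measures carried by the Cantor set and their cumulative masses -/

section

/-- The measure `ν` lives on the Cantor set. -/
def IsCarried (n : ℕ → ℕ) (c : ℕ → ℝ) (ν : Measure ℝ) : Prop :=
  ∀ S, MeasurableSet S → Disjoint S (cantorPoints n c) → ν S = 0

/-- The mass to the left of the component of level `k` with index `a`. -/
def cumMass (n : ℕ → ℕ) (c : ℕ → ℝ) (ν : Measure ℝ) (k : ℕ) (a : ℤ) : ℝ :=
  ν.real (Iio (compPos n c k a))

namespace Admissible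

lemma le_of_lt_compPos (h : Admissible n c) {k : ℕ} {b : ℤ} {y : ℝ} (hy : y ∈ cantorPoints n c)
    (hb : y < compPos n c k b) : y ≤ compPos n c k (b - 1) + compLen n c k := by
  obtain ⟨a, -, -, h1, h2⟩ := hy k
  have h3 : a < b := by
    by_contra hc
    have := (h.compPos_strictMono k).monotone (not_lt.1 hc)
    linarith
  have := (h.compPos_strictMono k).monotone (show a ≤ b - 1 by omega)
  linarith

lemma ge_of_compPos_add_lt (h : Admissible n c) {k : ℕ} {a : ℤ} {y : ℝ}
    (hy : y ∈ cantorPoints n c) (ha : compPos n c k a + compLen n c k < y) :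
    compPos n c k (a + 1) ≤ y := by
  obtain ⟨b, -, -, h1, h2⟩ := hy k
  have h3 : a < b := by
    by_contra hc
    have := (h.compPos_strictMono k).monotone (not_lt.1 hc)
    linarith
  have := (h.compPos_strictMono k).monotone (show a + 1 ≤ b by omega)
  linarith

end Admissible

section

variable {ν : Measure ℝ}

/-- A component and its first child share the left endpoint, which makes cumulative masses of
different levels directly comparable. -/
lemma cumMass_mul (h : Admissible n c) (k : ℕ) (e : ℤ) :
    cumMass n c ν (k + 1) (e * n (k + 1)) = cumMass n c ν k e := by
  unfold cumMass
  rw [h.compPos_mul]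

variable [IsFiniteMeasure ν]

/-- Inclusions need to be checked on the Cantor set only. This lets balls that reach into gaps be
compared with blocks of components. -/
lemma IsCarried.real_mono (hν : IsCarried n c ν) {S T : Set ℝ} (hS : MeasurableSet S)
    (hT : MeasurableSet T) (hST : ∀ x ∈ cantorPoints n c, x ∈ S → x ∈ T) :
    ν.real S ≤ ν.real T := by
  have h0 : ν (S \ T) = 0 := by
    refine hν _ (hS.diff hT) (Set.disjoint_left.2 fun x hx hxE => hx.2 (hST x hxE hx.1))
  have h1 : ν.real (S \ T) = 0 := by simp [Measure.real, h0]
  have h2 : ν.real S ≤ ν.real (S \ T) + ν.real T := by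
    refine (measureReal_mono (show S ⊆ (S \ T) ∪ T from fun x hx => ?_)).trans
      (measureReal_union_le _ _)
    by_cases hxT : x ∈ T
    · exact Or.inr hxT
    · exact Or.inl ⟨hx, hxT⟩
  linarith

lemma cumMass_mono (h : Admissible n c) (k : ℕ) : Monotone (cumMass n c ν k) := fun _ _ hab =>
  measureReal_mono (Iio_subset_Iio ((h.compPos_strictMono k).monotone hab))

lemma cumMass_sub (h : Admissible n c) (k : ℕ) {a b : ℤ} (hab : a ≤ b) :
    cumMass n c ν k b - cumMass n c ν k a = ν.real (Ico (compPos n c k a) (compPos n c k b)) := by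
  have h1 := (h.compPos_strictMono k).monotone hab
  have h2 : Iio (compPos n c k b) \ Iio (compPos n c k a) =
      Ico (compPos n c k a) (compPos n c k b) := by
    ext x; simp
  rw [← h2, measureReal_sdiff (Iio_subset_Iio h1) measurableSet_Iio]
  rfl

lemma IsCarried.block_le (hν : IsCarried n c ν) (h : Admissible n c) {k : ℕ} {a b : ℤ}
    (hab : a ≤ b) {S : Set ℝ} (hS : MeasurableSet S)
    (hST : ∀ x ∈ cantorPoints n c, compPos n c k a ≤ x →
      x ≤ compPos n c k (b - 1) + compLen n c k → x ∈ S) :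
    cumMass n c ν k b - cumMass n c ν k a ≤ ν.real S := by
  rw [cumMass_sub h k hab]
  exact hν.real_mono measurableSet_Ico hS fun x hx hx' =>
    hST x hx hx'.1 (h.le_of_lt_compPos hx hx'.2)

lemma IsCarried.le_block (hν : IsCarried n c ν) (h : Admissible n c) {k : ℕ} {a b : ℤ}
    (hab : a ≤ b) {S : Set ℝ} (hS : MeasurableSet S)
    (hST : ∀ x ∈ cantorPoints n c, x ∈ S → compPos n c k a ≤ x ∧ x < compPos n c k b) :
    ν.real S ≤ cumMass n c ν k b - cumMass n c ν k a := by
  rw [cumMass_sub h k hab]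
  exact hν.real_mono hS measurableSet_Ico hST

lemma IsCarried.cumMass_eq_of_ge (hν : IsCarried n c ν) (h : Admissible n c) {k : ℕ} {a b : ℤ}
    (ha : numComp n k ≤ a) (hb : numComp n k ≤ b) : cumMass n c ν k a = cumMass n c ν k b := by
  have key : ∀ {a b : ℤ}, numComp n k ≤ a → cumMass n c ν k b ≤ cumMass n c ν k a := by
    intro a b ha
    refine hν.real_mono measurableSet_Iio measurableSet_Iio fun x hx _ => ?_
    obtain ⟨m, -, h1, -, h3⟩ := hx k
    exact lt_of_le_of_lt h3 (h.compPos_add_compLen_lt (by omega))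
  exact le_antisymm (key hb) (key ha)

lemma IsCarried.real_block_zero (hν : IsCarried n c ν) (h : Admissible n c) {k : ℕ} {a b : ℤ}
    (ha : numComp n k ≤ a) (hab : a ≤ b) : cumMass n c ν k b - cumMass n c ν k a = 0 := by
  rw [hν.cumMass_eq_of_ge h ha (ha.trans hab), sub_self]

end

end

/-! ### Doubling measures: comparison of neighbouring blocks -/

section

/-- The measure `ν` is doubling on the Cantor set with constant `D`. -/
def IsDoublingOn (n : ℕ → ℕ) (c : ℕ → ℝ) (ν : Measure ℝ) (D : ℝ) : Prop :=
  ∀ x ∈ cantorPoints n c, ∀ r : ℝ, 0 < r →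
    ν.real (Metric.ball x (2 * r)) ≤ D * ν.real (Metric.ball x r)

variable {ν : Measure ℝ} {D : ℝ}

lemma IsDoublingOn.pow (hD : IsDoublingOn n c ν D) (hD1 : 1 ≤ D) {x : ℝ}
    (hx : x ∈ cantorPoints n c) {r : ℝ} (hr : 0 < r) (p : ℕ) :
    ν.real (Metric.ball x (2 ^ p * r)) ≤ D ^ p * ν.real (Metric.ball x r) := by
  induction p with
  | zero => simp
  | succ p ih =>
    have h1 := hD x hx (2 ^ p * r) (by positivity)
    have h2 : (2 : ℝ) * (2 ^ p * r) = 2 ^ (p + 1) * r := by ring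
    rw [h2] at h1
    calc _ ≤ _ := h1
      _ ≤ D * (D ^ p * ν.real (Metric.ball x r)) := mul_le_mul_of_nonneg_left ih (by linarith)
      _ = _ := by ring

variable [IsFiniteMeasure ν]

/-- A component shorter than the sibling gap carries a fixed part of the mass of a ball whose
radius is that gap. -/
lemma IsDoublingOn.exists_ball_gapLen_le (hD : IsDoublingOn n c ν D) (hD1 : 1 ≤ D)
    (hν : IsCarried n c ν) (h : Admissible n c) {k : ℕ}
    (hk : compLen n c (k + 1) ≤ gapLen n c (k + 1)) {a : ℤ} (h0 : 0 ≤ a)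
    (h1 : a < numComp n (k + 1)) :
    ∃ x ∈ cantorPoints n c, compPos n c (k + 1) a ≤ x ∧
      x ≤ compPos n c (k + 1) a + compLen n c (k + 1) ∧
      ν.real (Metric.ball x (gapLen n c (k + 1))) ≤
        D ^ 2 * (cumMass n c ν (k + 1) (a + 1) - cumMass n c ν (k + 1) a) := by
  set δ := compLen n c (k + 1) with hδ
  set ε := gapLen n c (k + 1) with hε
  have hδ0 : 0 < δ := h.compLen_pos _
  have hm := h.compPos_strictMono (k + 1)
  have hM : 0 ≤ cumMass n c ν (k + 1) (a + 1) - cumMass n c ν (k + 1) a :=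
    sub_nonneg.2 (cumMass_mono h (k + 1) (by omega))
  have hprev := h.compPos_succ (k + 1) (a - 1)
  rw [sub_add_cancel] at hprev
  have hnext := h.compPos_succ (k + 1) a
  rw [← hδ] at hprev hnext
  have hηr := h.gapAfter_pos (k + 1) a
  have hηl := h.gapAfter_pos (k + 1) (a - 1)
  have hor1 := h.gapAfter_or k a
  have hor2 := h.gapAfter_or k (a - 1)
  rw [sub_add_cancel] at hor2
  rw [← hε] at hor1 hor2
  -- Two consecutive gaps are never both inherited. The centre is taken to be an endpoint facing a
  -- sibling gap, so that the ball of radius ε meets no other component on that side.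
  have hlr : gapAfter n c (k + 1) (a - 1) = ε ∨ gapAfter n c (k + 1) a = ε := by
    rcases hor2 with h' | h'
    · exact Or.inl h'
    · exact Or.inr h'.1
  have hD2 : 1 ≤ D ^ 2 := one_le_pow₀ hD1
  have trivial_bound : ∀ x, (∀ y ∈ cantorPoints n c, y ∈ Metric.ball x ε →
      compPos n c (k + 1) a ≤ y ∧ y < compPos n c (k + 1) (a + 1)) →
      ν.real (Metric.ball x ε) ≤
        D ^ 2 * (cumMass n c ν (k + 1) (a + 1) - cumMass n c ν (k + 1) a) := by
    intro x hx
    have := hν.le_block h (show a ≤ a + 1 by omega) Metric.isOpen_ball.measurableSet hx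
    nlinarith
  have far_bound : ∀ x ∈ cantorPoints n c, ∀ R, 0 < R → (∀ y ∈ cantorPoints n c,
      y ∈ Metric.ball x R → compPos n c (k + 1) a ≤ y ∧ y < compPos n c (k + 1) (a + 1)) →
      (∀ y ∈ cantorPoints n c, y ∈ Metric.ball x ε → y ∈ Metric.ball x (2 ^ 2 * R)) →
      ν.real (Metric.ball x ε) ≤
        D ^ 2 * (cumMass n c ν (k + 1) (a + 1) - cumMass n c ν (k + 1) a) := by
    intro x hx R hR h1 h2
    have e1 := hν.real_mono Metric.isOpen_ball.measurableSet Metric.isOpen_ball.measurableSet h2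
    have e2 := hD.pow hD1 hx hR 2
    have e3 := hν.le_block h (show a ≤ a + 1 by omega) Metric.isOpen_ball.measurableSet h1
    have e4 := mul_le_mul_of_nonneg_left e3 (show 0 ≤ D ^ 2 by positivity)
    linarith
  rcases hlr with hl | hr
  · refine ⟨_, h.compPos_mem h0 h1, le_rfl, by linarith, ?_⟩
    rw [hl] at hprev
    have left : ∀ y ∈ cantorPoints n c, ∀ R ≤ ε,
        y ∈ Metric.ball (compPos n c (k + 1) a) R → compPos n c (k + 1) a ≤ y := by
      intro y hy R hR hyb
      rw [Metric.mem_ball, Real.dist_eq, abs_lt] at hyb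
      by_contra hc
      have := h.le_of_lt_compPos hy (not_le.1 hc)
      linarith
    by_cases hη : ε ≤ gapAfter n c (k + 1) a
    · refine trivial_bound _ fun y hy hyb => ⟨left y hy ε le_rfl hyb, ?_⟩
      rw [Metric.mem_ball, Real.dist_eq, abs_lt] at hyb
      linarith
    · rw [not_le] at hη
      have hnn : gapAfter n c (k + 1) (a + 1) = ε := by
        rcases hor1 with h' | h'
        · linarith
        · exact h'.1
      have hnext2 := h.compPos_succ (k + 1) (a + 1)
      rw [hnn, ← hδ] at hnext2
      have m1 := le_max_left δ (gapAfter n c (k + 1) a)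
      have m2 := le_max_right δ (gapAfter n c (k + 1) a)
      have m3 : max δ (gapAfter n c (k + 1) a) ≤ ε := max_le hk hη.le
      -- Here the gap η on the other side is shorter than ε, hence inherited, so the gap after the
      -- next component is a sibling gap and B(x, ε) meets only these two components. With R = max δ
      -- η, the ball B(x, R) stays in the first one because R < δ + η, and both lie within 2δ + η ≤
      -- 3R of x. Two doublings of R therefore suffice.
      refine far_bound _ (h.compPos_mem h0 h1) (max δ (gapAfter n c (k + 1) a)) (by linarith)
        (fun y hy hyb => ⟨left y hy _ m3 hyb, ?_⟩) (fun y hy hyb => ?_)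
      · rw [Metric.mem_ball, Real.dist_eq, abs_lt] at hyb
        rcases max_cases δ (gapAfter n c (k + 1) a) with hh | hh <;> linarith
      · have hy1 := left y hy ε le_rfl hyb
        rw [Metric.mem_ball, Real.dist_eq, abs_lt] at hyb ⊢
        have := h.le_of_lt_compPos (k := k + 1) (b := a + 1 + 1) hy (by linarith)
        rw [add_sub_cancel_right] at this
        constructor <;> linarith
  · refine ⟨_, h.compPos_add_mem h0 h1, by linarith, le_rfl, ?_⟩
    rw [← hδ]
    rw [hr] at hnext
    have right : ∀ y ∈ cantorPoints n c, ∀ R ≤ ε,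
        y ∈ Metric.ball (compPos n c (k + 1) a + δ) R → y < compPos n c (k + 1) (a + 1) := by
      intro y hy R hR hyb
      rw [Metric.mem_ball, Real.dist_eq, abs_lt] at hyb
      linarith
    by_cases hη : ε ≤ gapAfter n c (k + 1) (a - 1)
    · refine trivial_bound _ fun y hy hyb => ⟨?_, right y hy ε le_rfl hyb⟩
      rw [Metric.mem_ball, Real.dist_eq, abs_lt] at hyb
      by_contra hc
      have := h.le_of_lt_compPos hy (not_le.1 hc)
      linarith
    · rw [not_le] at hη
      have hnn : gapAfter n c (k + 1) (a - 1 - 1) = ε := by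
        rcases hor2 with h' | h'
        · linarith
        · exact h'.2
      have hprev2 := h.compPos_succ (k + 1) (a - 1 - 1)
      rw [hnn, ← hδ, sub_add_cancel] at hprev2
      have m1 := le_max_left δ (gapAfter n c (k + 1) (a - 1))
      have m2 := le_max_right δ (gapAfter n c (k + 1) (a - 1))
      have m3 : max δ (gapAfter n c (k + 1) (a - 1)) ≤ ε := max_le hk hη.le
      refine far_bound _ (h.compPos_add_mem h0 h1) (max δ (gapAfter n c (k + 1) (a - 1)))
        (by linarith) (fun y hy hyb => ⟨?_, right y hy _ m3 hyb⟩) (fun y hy hyb => ?_)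
      · rw [Metric.mem_ball, Real.dist_eq, abs_lt] at hyb
        by_contra hc
        have := h.le_of_lt_compPos hy (not_le.1 hc)
        rcases max_cases δ (gapAfter n c (k + 1) (a - 1)) with hh | hh <;> linarith
      · have hy1 := right y hy ε le_rfl hyb
        rw [Metric.mem_ball, Real.dist_eq, abs_lt] at hyb ⊢
        have h5 := h.le_of_lt_compPos hy hy1
        rw [add_sub_cancel_right] at h5
        have h6 : compPos n c (k + 1) (a - 1) ≤ y := by
          by_contra hc
          have := h.le_of_lt_compPos hy (not_le.1 hc)
          linarith
        constructor <;> linarith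

/-- A component carries a fixed part of the mass of a ball of comparable size. -/
lemma IsDoublingOn.exists_ball_compLen_le (hD : IsDoublingOn n c ν D) (hD1 : 1 ≤ D)
    (hν : IsCarried n c ν) (h : Admissible n c) {k : ℕ} {a : ℤ} (h0 : 0 ≤ a)
    (h1 : a < numComp n k) :
    ∃ x ∈ cantorPoints n c, compPos n c k a ≤ x ∧ x ≤ compPos n c k a + compLen n c k ∧
      ν.real (Metric.ball x (compLen n c k / 4)) ≤
        D ^ 2 * (cumMass n c ν k (a + 1) - cumMass n c ν k a) := by
  have hδ0 := h.compLen_pos k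
  have hδ1 := h.compLen_pos (k + 1)
  have hs0 := h.step_pos (k := k + 1) (by omega)
  have hε0 := h.gapLen_pos (k := k + 1) (by omega)
  have heq := h.compLen_eq k
  have hn2 := h.two_le_real k
  have hn2' := h.two_le_int k
  have hs : step n c (k + 1) = compLen n c (k + 1) + gapLen n c (k + 1) := rfl
  have hD2 : 1 ≤ D ^ 2 := one_le_pow₀ hD1
  have hM : 0 ≤ cumMass n c ν k (a + 1) - cumMass n c ν k a :=
    sub_nonneg.2 (cumMass_mono h k (by omega))
  -- If a child starts in the middle half of the component, the ball of radius δ_k / 4 about its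
  -- left endpoint works. Otherwise the step exceeds 3δ_k / 4, so δ_{k+1} < δ_k / 4 and the sibling
  -- gap exceeds δ_k / 2; the first child then already controls a large enough ball.
  by_cases hw : ∃ i : ℤ, 0 ≤ i ∧ i < n (k + 1) ∧ compLen n c k / 4 ≤ i * step n c (k + 1) ∧
      i * step n c (k + 1) ≤ 3 / 4 * compLen n c k
  · obtain ⟨i, hi, hin, hi1, hi2⟩ := hw
    have hr := (h.child_mem_range hi hin).2 ⟨h0, h1⟩
    have hpc := h.compPos_child k a i hi hin
    refine ⟨_, h.compPos_mem hr.1 hr.2, by linarith, by linarith, ?_⟩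
    have := hν.le_block h (show a ≤ a + 1 by omega)
      (Metric.isOpen_ball (x := compPos n c (k + 1) (a * n (k + 1) + i))
        (ε := compLen n c k / 4)).measurableSet (k := k) (fun y hy hyb => by
          rw [Metric.mem_ball, Real.dist_eq, abs_lt] at hyb
          have := h.compPos_succ k a
          have := h.gapAfter_pos k a
          constructor <;> linarith)
    nlinarith
  · have hbig : 3 / 4 * compLen n c k < step n c (k + 1) := by
      by_contra hc
      rw [not_lt] at hc
      refine hw ?_
      -- Steps of length at most δ_k / 2 cannot jump over the middle half; a step between δ_k / 2
      -- and 3δ_k / 4 lands in it at once.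
      by_cases hs2 : step n c (k + 1) ≤ compLen n c k / 2
      · refine ⟨⌈compLen n c k / 4 / step n c (k + 1)⌉, Int.ceil_nonneg (by positivity), ?_, ?_, ?_⟩
        · have h3 := Int.ceil_lt_add_one (compLen n c k / 4 / step n c (k + 1))
          by_contra hcc
          have h4 : ((n (k + 1) : ℤ) : ℝ) ≤ ⌈compLen n c k / 4 / step n c (k + 1)⌉ := by
            exact_mod_cast not_lt.1 hcc
          push_cast at h4
          have h5 : (n (k + 1) : ℝ) - 1 < compLen n c k / 4 / step n c (k + 1) := by linarith
          rw [lt_div_iff₀ hs0] at h5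
          nlinarith
        · have h3 := Int.le_ceil (compLen n c k / 4 / step n c (k + 1))
          rwa [div_le_iff₀ hs0] at h3
        · have h3 := Int.ceil_lt_add_one (compLen n c k / 4 / step n c (k + 1))
          have h4 : (⌈compLen n c k / 4 / step n c (k + 1)⌉ : ℝ) - 1 <
            compLen n c k / 4 / step n c (k + 1) := by linarith
          rw [lt_div_iff₀ hs0] at h4
          linarith
      · exact ⟨1, by omega, by omega, by push_cast; linarith, by push_cast; linarith⟩
    have h3 : step n c (k + 1) ≤ ((n (k + 1) : ℝ) - 1) * step n c (k + 1) := by nlinarith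
    have hr := (h.child_mem_range (k := k) (e := a) (i := 0) le_rfl (by omega)).2 ⟨h0, h1⟩
    have hpc := h.compPos_mul k a
    rw [add_zero] at hr
    obtain ⟨x, hx, hx1, hx2, hx3⟩ :=
      hD.exists_ball_gapLen_le hD1 hν h (by linarith) hr.1 hr.2
    refine ⟨x, hx, by linarith, by linarith, ?_⟩
    have h4 : ν.real (Metric.ball x (compLen n c k / 4)) ≤
        ν.real (Metric.ball x (gapLen n c (k + 1))) :=
      measureReal_mono (Metric.ball_subset_ball (by linarith))
    have h5 : cumMass n c ν (k + 1) (a * n (k + 1) + 1) ≤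
        cumMass n c ν (k + 1) ((a + 1) * n (k + 1)) := cumMass_mono h _ (by linarith)
    rw [cumMass_mul h] at h5 hx3
    nlinarith

/-- A component carries a fixed part of the mass of a ball whose radius is comparable to the
distance of neighbouring siblings. -/
lemma IsDoublingOn.ball_step_le (hD : IsDoublingOn n c ν D) (hD1 : 1 ≤ D)
    (hν : IsCarried n c ν) (h : Admissible n c) {k : ℕ} {a : ℤ} (h0 : 0 ≤ a)
    (h1 : a < numComp n (k + 1)) :
    ν.real (Metric.ball (compPos n c (k + 1) a) (61 * step n c (k + 1))) ≤
      D ^ 11 * (cumMass n c ν (k + 1) (a + 1) - cumMass n c ν (k + 1) a) := by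
  have hδ0 := h.compLen_pos (k + 1)
  have hε0 := h.gapLen_pos (k := k + 1) (by omega)
  have hs : step n c (k + 1) = compLen n c (k + 1) + gapLen n c (k + 1) := rfl
  have key : ∃ x ∈ cantorPoints n c, compPos n c (k + 1) a ≤ x ∧
      x ≤ compPos n c (k + 1) a + compLen n c (k + 1) ∧
      ν.real (Metric.ball x (step n c (k + 1) / 8)) ≤
        D ^ 2 * (cumMass n c ν (k + 1) (a + 1) - cumMass n c ν (k + 1) a) := by
    rcases le_total (compLen n c (k + 1)) (gapLen n c (k + 1)) with hle | hle
    · obtain ⟨x, hx, hx1, hx2, hx3⟩ := hD.exists_ball_gapLen_le hD1 hν h hle h0 h1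
      exact ⟨x, hx, hx1, hx2,
        (measureReal_mono (Metric.ball_subset_ball (by linarith))).trans hx3⟩
    · obtain ⟨x, hx, hx1, hx2, hx3⟩ := hD.exists_ball_compLen_le hD1 hν h h0 h1
      exact ⟨x, hx, hx1, hx2,
        (measureReal_mono (Metric.ball_subset_ball (by linarith))).trans hx3⟩
  obtain ⟨x, hx, hx1, hx2, hx3⟩ := key
  -- The centre moves by less than one step and 61 + 1 ≤ 64 = 2 ^ 9 / 8. Nine doublings, together
  -- with the factor D ^ 2, give D ^ 11.
  have e1 : ν.real (Metric.ball (compPos n c (k + 1) a) (61 * step n c (k + 1))) ≤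
      ν.real (Metric.ball x (2 ^ 9 * (step n c (k + 1) / 8))) := by
    refine measureReal_mono (Metric.ball_subset_ball' ?_)
    rw [Real.dist_eq, abs_sub_comm, abs_of_nonneg (by linarith)]
    linarith
  have e2 := hD.pow hD1 hx (show 0 < step n c (k + 1) / 8 by linarith) 9
  have e3 := mul_le_mul_of_nonneg_left hx3 (show 0 ≤ D ^ 9 by positivity)
  calc _ ≤ _ := e1
    _ ≤ _ := e2
    _ ≤ _ := e3
    _ = _ := by ring


/-- A block of siblings carries a fixed part of the mass of a ball of comparable size. -/
lemma IsDoublingOn.ball_block_le (hD : IsDoublingOn n c ν D) (hD1 : 1 ≤ D)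
    (hν : IsCarried n c ν) (h : Admissible n c) {k : ℕ} {e i l : ℤ} (h0 : 0 ≤ e)
    (h1 : e < numComp n k) (hi : 0 ≤ i) (hl : 1 ≤ l) (hil : i + l ≤ n (k + 1)) :
    ν.real (Metric.ball (compPos n c (k + 1) (e * n (k + 1) + i)) (12 * l * step n c (k + 1))) ≤
      D ^ 11 * (cumMass n c ν (k + 1) (e * n (k + 1) + (i + l)) -
        cumMass n c ν (k + 1) (e * n (k + 1) + i)) := by
  have hs0 := h.step_pos (k := k + 1) (by omega)
  have hδ0 := h.compLen_pos (k + 1)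
  -- For l ≤ 5 the first component alone suffices, as 12 * 5 ≤ 61. For longer blocks the ball of
  -- radius l / 4 steps about the middle component stays in the block, and six doublings give 16 l ≥
  -- 12 l + l / 2.
  by_cases hl5 : l ≤ 5
  · have hr := (h.child_mem_range hi (show i < n (k + 1) by omega)).2 ⟨h0, h1⟩
    have e1 := hD.ball_step_le hD1 hν h hr.1 hr.2
    have hl5' : (l : ℝ) ≤ 5 := by exact_mod_cast hl5
    have e2 : ν.real (Metric.ball (compPos n c (k + 1) (e * n (k + 1) + i))
        (12 * l * step n c (k + 1))) ≤
        ν.real (Metric.ball (compPos n c (k + 1) (e * n (k + 1) + i)) (61 * step n c (k + 1))) :=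
      measureReal_mono (Metric.ball_subset_ball (by nlinarith))
    have e3 : cumMass n c ν (k + 1) (e * n (k + 1) + i + 1) ≤
        cumMass n c ν (k + 1) (e * n (k + 1) + (i + l)) := cumMass_mono h _ (by omega)
    have e4 : (1 : ℝ) ≤ D ^ 11 := one_le_pow₀ hD1
    nlinarith
  · obtain ⟨m, hm1, hm2⟩ : ∃ m : ℤ, 2 * m ≤ l ∧ l ≤ 2 * m + 1 := ⟨l / 2, by omega, by omega⟩
    have hl4 : (6 : ℝ) ≤ l := by exact_mod_cast (show 6 ≤ l by omega)
    have hm1' : 2 * (m : ℝ) ≤ l := by exact_mod_cast hm1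
    have hm2' : (l : ℝ) ≤ 2 * m + 1 := by exact_mod_cast hm2
    have hr := (h.child_mem_range (k := k) (e := e) (i := i + m) (by omega) (by omega)).2 ⟨h0, h1⟩
    have p1 := h.compPos_child k e i hi (by omega)
    have p2 := h.compPos_child k e (i + m) (by omega) (by omega)
    have p3 := h.compPos_child k e (i + l - 1) (by omega) (by omega)
    push_cast at p1 p2 p3
    have hR : 0 < (l : ℝ) / 4 * step n c (k + 1) := by positivity
    have hlt := h.compPos_add_compLen_lt (k := k + 1)
      (show e * n (k + 1) + (i + l - 1) < e * n (k + 1) + (i + l) by omega)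
    have e1 := hν.le_block h
      (show e * (n (k + 1) : ℤ) + i ≤ e * n (k + 1) + (i + l) by omega)
      (Metric.isOpen_ball (x := compPos n c (k + 1) (e * n (k + 1) + (i + m)))
        (ε := (l : ℝ) / 4 * step n c (k + 1))).measurableSet (k := k + 1) (fun y hy hyb => by
          rw [Metric.mem_ball, Real.dist_eq, abs_lt] at hyb
          constructor <;> nlinarith)
    have e2 := hD.pow hD1 (h.compPos_mem hr.1 hr.2) hR 6
    have e3 : ν.real (Metric.ball (compPos n c (k + 1) (e * n (k + 1) + i))
        (12 * l * step n c (k + 1))) ≤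
        ν.real (Metric.ball (compPos n c (k + 1) (e * n (k + 1) + (i + m)))
          (2 ^ 6 * ((l : ℝ) / 4 * step n c (k + 1)))) := by
      refine measureReal_mono (Metric.ball_subset_ball' ?_)
      rw [Real.dist_eq, abs_sub_comm, abs_of_nonneg] <;> nlinarith
    have e5 : D ^ 6 ≤ D ^ 11 := pow_le_pow_right₀ hD1 (by norm_num)
    have e6 : 0 ≤ cumMass n c ν (k + 1) (e * n (k + 1) + (i + l)) -
        cumMass n c ν (k + 1) (e * n (k + 1) + i) :=
      sub_nonneg.2 (cumMass_mono h _ (by omega))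
    have e7 := mul_le_mul_of_nonneg_left e1 (show 0 ≤ D ^ 6 by positivity)
    have e8 := mul_le_mul_of_nonneg_right e5 e6
    linarith

/-- Neighbouring blocks of siblings of equal length have comparable masses. -/
lemma IsDoublingOn.sibling_block_le (hD : IsDoublingOn n c ν D) (hD1 : 1 ≤ D)
    (hν : IsCarried n c ν) (h : Admissible n c) {k : ℕ} {e i j l : ℤ} (h0 : 0 ≤ e)
    (h1 : e < numComp n k) (hi : 0 ≤ i) (hj : 0 ≤ j) (hl : 1 ≤ l) (hij : i ≤ j + l)
    (hji : j ≤ i + l) (hil : i + l ≤ n (k + 1)) (hjl : j + l ≤ n (k + 1)) :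
    cumMass n c ν (k + 1) (e * n (k + 1) + (j + l)) - cumMass n c ν (k + 1) (e * n (k + 1) + j) ≤
      D ^ 11 * (cumMass n c ν (k + 1) (e * n (k + 1) + (i + l)) -
        cumMass n c ν (k + 1) (e * n (k + 1) + i)) := by
  refine le_trans ?_ (hD.ball_block_le hD1 hν h h0 h1 hi hl hil)
  have hs0 := h.step_pos (k := k + 1) (by omega)
  have hδ := h.compLen_lt_step k
  refine hν.block_le h (by omega) Metric.isOpen_ball.measurableSet fun y _ hy1 hy2 => ?_
  rw [show e * (n (k + 1) : ℤ) + (j + l) - 1 = e * n (k + 1) + (j + l - 1) by ring,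
    h.compPos_child k e _ (by omega) (by omega)] at hy2
  rw [h.compPos_child k e _ hj (by omega)] at hy1
  rw [h.compPos_child k e _ hi (by omega), Metric.mem_ball, Real.dist_eq, abs_lt]
  push_cast at hy1 hy2
  have hij' : (i : ℝ) ≤ j + l := by exact_mod_cast hij
  have hji' : (j : ℝ) ≤ i + l := by exact_mod_cast hji
  have hl' : (1 : ℝ) ≤ l := by exact_mod_cast hl
  constructor <;> nlinarith

/-- The position of the children of two consecutive components. -/
lemma Admissible.compPos_child_two (h : Admissible n c) {k : ℕ} {e i : ℤ} (hi : 0 ≤ i)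
    (hin : i < 2 * n (k + 1)) :
    (i < n (k + 1) ∧ compPos n c (k + 1) (e * n (k + 1) + i) =
      compPos n c k e + i * step n c (k + 1)) ∨
    (n (k + 1) ≤ i ∧ compPos n c (k + 1) (e * n (k + 1) + i) =
      compPos n c k e + i * step n c (k + 1) + (gapAfter n c k e - gapLen n c (k + 1))) := by
  by_cases hlt : i < n (k + 1)
  · exact Or.inl ⟨hlt, h.compPos_child k e i hi hlt⟩
  · refine Or.inr ⟨by omega, ?_⟩
    rw [show e * (n (k + 1) : ℤ) + i = (e + 1) * n (k + 1) + (i - n (k + 1)) by ring,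
      h.compPos_child k (e + 1) _ (by omega) (by omega), h.compPos_succ, h.compLen_eq k]
    unfold step
    push_cast
    ring

/-- A block of children of two consecutive components has a large part in one of them. -/
lemma exists_subblock {i l m : ℤ} (hl : 1 ≤ l) :
    ∃ u l₀, i ≤ u ∧ u + l₀ ≤ i + l ∧ 1 ≤ l₀ ∧ l ≤ 2 * l₀ ∧ (u + l₀ ≤ m ∨ m ≤ u) := by
  by_cases h1 : i + l ≤ m
  · exact ⟨i, l, by omega, by omega, by omega, by omega, by omega⟩
  by_cases h2 : m ≤ i
  · exact ⟨i, l, by omega, by omega, by omega, by omega, by omega⟩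
  by_cases h3 : i + l - m ≤ m - i
  · exact ⟨i, m - i, by omega, by omega, by omega, by omega, by omega⟩
  · exact ⟨m, i + l - m, by omega, by omega, by omega, by omega, by omega⟩

/-- Neighbouring blocks of equal length of children of two consecutive components have comparable
masses if they are not shorter than the gap between the components. -/
lemma IsDoublingOn.cousin_block_le (hD : IsDoublingOn n c ν D) (hD1 : 1 ≤ D)
    (hν : IsCarried n c ν) (h : Admissible n c) {k : ℕ} {e i j l : ℤ} (h0 : 0 ≤ e)
    (h1 : e + 1 < numComp n k) (hi : 0 ≤ i) (hj : 0 ≤ j) (hl : 1 ≤ l) (hij : i ≤ j + l)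
    (hji : j ≤ i + l) (hil : i + l ≤ 2 * n (k + 1)) (hjl : j + l ≤ 2 * n (k + 1))
    (hgap : gapAfter n c k e ≤ (l + 1) * step n c (k + 1)) :
    cumMass n c ν (k + 1) (e * n (k + 1) + (j + l)) - cumMass n c ν (k + 1) (e * n (k + 1) + j) ≤
      D ^ 11 * (cumMass n c ν (k + 1) (e * n (k + 1) + (i + l)) -
        cumMass n c ν (k + 1) (e * n (k + 1) + i)) := by
  -- The block at i may straddle both parents, so it is replaced by a sub-block of at least half its
  -- length inside one of them. Its ball has radius 12 l₀ ≥ 6 l steps. This covers the block at j,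
  -- which extends over at most 2 l positions on either side, plus a gap of at most l + 1 ≤ 2 l
  -- steps.
  obtain ⟨u, l₀, hu1, hu2, hl₀, hl₁, hu3⟩ := exists_subblock (i := i) (m := n (k + 1)) hl
  have hs0 := h.step_pos (k := k + 1) (by omega)
  have hδ := h.compLen_lt_step k
  have hε := h.gapLen_pos (k := k + 1) (by omega)
  have hg0 := h.gapAfter_pos k e
  have e1 : ν.real (Metric.ball (compPos n c (k + 1) (e * n (k + 1) + u))
      (12 * l₀ * step n c (k + 1))) ≤
      D ^ 11 * (cumMass n c ν (k + 1) (e * n (k + 1) + (u + l₀)) -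
        cumMass n c ν (k + 1) (e * n (k + 1) + u)) := by
    rcases hu3 with hu | hu
    · exact hD.ball_block_le hD1 hν h h0 (by omega) (by omega) hl₀ hu
    · have := hD.ball_block_le hD1 hν h (k := k) (e := e + 1) (i := u - n (k + 1)) (l := l₀)
        (by omega) h1 (by omega) hl₀ (by omega)
      rwa [show (e + 1) * (n (k + 1) : ℤ) + (u - n (k + 1)) = e * n (k + 1) + u by ring,
        show (e + 1) * (n (k + 1) : ℤ) + (u - n (k + 1) + l₀) = e * n (k + 1) + (u + l₀) by ring]
        at this
  have e2 : cumMass n c ν (k + 1) (e * n (k + 1) + (u + l₀)) ≤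
      cumMass n c ν (k + 1) (e * n (k + 1) + (i + l)) := cumMass_mono h _ (by omega)
  have e3 : cumMass n c ν (k + 1) (e * n (k + 1) + i) ≤
      cumMass n c ν (k + 1) (e * n (k + 1) + u) := cumMass_mono h _ (by omega)
  have e4 : (0 : ℝ) ≤ D ^ 11 := by positivity
  refine le_trans ?_ (e1.trans (mul_le_mul_of_nonneg_left (by linarith) e4))
  refine hν.block_le h (by omega) Metric.isOpen_ball.measurableSet fun y _ hy1 hy2 => ?_
  rw [show e * (n (k + 1) : ℤ) + (j + l) - 1 = e * n (k + 1) + (j + l - 1) by ring] at hy2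
  rw [Metric.mem_ball, Real.dist_eq, abs_lt]
  have hij' : (u : ℝ) + 1 ≤ j + 2 * l := by exact_mod_cast (show u + 1 ≤ j + 2 * l by omega)
  have hji' : (j : ℝ) ≤ u + l := by exact_mod_cast (show j ≤ u + l by omega)
  have hl' : (1 : ℝ) ≤ l := by exact_mod_cast hl
  have hl2' : (l : ℝ) ≤ 2 * l₀ := by exact_mod_cast hl₁
  have f1 : ((l : ℝ) + 1) * step n c (k + 1) ≤ 2 * l * step n c (k + 1) := by nlinarith
  have f2 : (l : ℝ) * step n c (k + 1) ≤ 2 * l₀ * step n c (k + 1) := by nlinarith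
  have f3 : (1 : ℝ) * step n c (k + 1) ≤ l * step n c (k + 1) := by nlinarith
  have f4 : ((u : ℝ) + 1) * step n c (k + 1) ≤ (j + 2 * l) * step n c (k + 1) := by nlinarith
  have f5 : (j : ℝ) * step n c (k + 1) ≤ (u + l) * step n c (k + 1) := by nlinarith
  have hst : step n c (k + 1) = compLen n c (k + 1) + gapLen n c (k + 1) := rfl
  have hd0 := h.compLen_pos (k + 1)
  have q1 := h.compPos_child_two (k := k) (e := e) (i := j) hj (by omega)
  have q2 := h.compPos_child_two (k := k) (e := e) (i := u) (by omega) (by omega)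
  have q3 := h.compPos_child_two (k := k) (e := e) (i := j + l - 1) (by omega) (by omega)
  push_cast at q3
  constructor
  · rcases q1 with ⟨-, q1⟩ | ⟨-, q1⟩ <;> rcases q2 with ⟨-, q2⟩ | ⟨-, q2⟩ <;> linarith
  · rcases q3 with ⟨-, q3⟩ | ⟨-, q3⟩ <;> rcases q2 with ⟨-, q2⟩ | ⟨-, q2⟩ <;> linarith

/-- Consecutive components whose gap is not longer than they are have comparable masses. -/
lemma IsDoublingOn.neighbour_le (hD : IsDoublingOn n c ν D) (hD1 : 1 ≤ D)
    (hν : IsCarried n c ν) (h : Admissible n c) {k : ℕ} {e : ℤ} (h0 : 0 ≤ e)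
    (h1 : e + 1 < numComp n (k + 1))
    (hgap : gapAfter n c (k + 1) e ≤ compLen n c (k + 1)) :
    cumMass n c ν (k + 1) (e + 2) - cumMass n c ν (k + 1) (e + 1) ≤
        D ^ 11 * (cumMass n c ν (k + 1) (e + 1) - cumMass n c ν (k + 1) e) ∧
      cumMass n c ν (k + 1) (e + 1) - cumMass n c ν (k + 1) e ≤
        D ^ 11 * (cumMass n c ν (k + 1) (e + 2) - cumMass n c ν (k + 1) (e + 1)) := by
  have hδ := h.compLen_lt_step k
  have hδ0 := h.compLen_pos (k + 1)
  have hg0 := h.gapAfter_pos (k + 1) e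
  have hsucc := h.compPos_succ (k + 1) e
  constructor
  · refine le_trans ?_ (hD.ball_step_le hD1 hν h h0 (by omega))
    refine hν.block_le h (by omega) Metric.isOpen_ball.measurableSet fun y _ hy1 hy2 => ?_
    rw [show e + 2 - 1 = e + 1 by ring] at hy2
    rw [Metric.mem_ball, Real.dist_eq, abs_lt]
    constructor <;> linarith
  · have := hD.ball_step_le hD1 hν h (show 0 ≤ e + 1 by omega) h1
    rw [show e + 1 + 1 = e + 2 by ring] at this
    refine le_trans ?_ this
    refine hν.block_le h (by omega) Metric.isOpen_ball.measurableSet fun y _ hy1 hy2 => ?_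
    rw [add_sub_cancel_right] at hy2
    rw [Metric.mem_ball, Real.dist_eq, abs_lt]
    constructor <;> linarith

end

/-! ### From block comparisons to doubling -/

section

/-- Adjacent or overlapping blocks of equal length have comparable masses, where `F i` is the mass
to the left of position `i`. -/
def IsBlockUniform (F : ℤ → ℝ) (C : ℝ) (m : ℤ) : Prop :=
  ∀ i j l, 1 ≤ l → 0 ≤ i → i ≤ j → j ≤ i + l → j + l ≤ m →
    F (i + l) - F i ≤ C * (F (j + l) - F j) ∧ F (j + l) - F j ≤ C * (F (i + l) - F i)

section Blocks

variable {F : ℤ → ℝ} {C : ℝ} {m : ℤ}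

/-- Appending the adjacent block of equal length doubles the block and multiplies its mass by at
most 1 + C. -/
lemma IsBlockUniform.extend_right (hF : IsBlockUniform F C m) (hC : 0 ≤ C) (hmono : Monotone F)
    {b l : ℤ} (hb : 0 ≤ b) (hl : 1 ≤ l) (hbl : b + l ≤ m) (p : ℕ) :
    ∃ L, l ≤ L ∧ b + L ≤ m ∧ (b + 2 ^ p * l ≤ b + L ∨ b + L = m) ∧
      F (b + L) - F b ≤ (1 + C) ^ p * (F (b + l) - F b) := by
  induction p with
  | zero => exact ⟨l, le_rfl, hbl, by simp, by simp⟩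
  | succ p ih =>
    obtain ⟨L, h1, h2, h3, h4⟩ := ih
    rcases h3 with h3 | h3
    -- Near the right end the adjacent block does not fit and is pushed back until it does; here the
    -- comparison of overlapping blocks is needed.
    · have h5 := (hF b (min (b + L) (m - L)) L (by omega) hb (by omega) (by omega) (by omega)).2
      have h6 : F (b + min (2 * L) (m - b)) - F (b + L) ≤
          F (min (b + L) (m - L) + L) - F (min (b + L) (m - L)) := by
        have e1 : b + min (2 * L) (m - b) = min (b + L) (m - L) + L := by omega
        have e2 := hmono (show min (b + L) (m - L) ≤ b + L by omega)
        rw [e1]; linarith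
      refine ⟨min (2 * L) (m - b), by omega, by omega, ?_, ?_⟩
      · rw [pow_succ]
        by_cases hh : 2 * L ≤ m - b
        · left; rw [min_eq_left hh]; linarith
        · right; omega
      · have h7 := mul_le_mul_of_nonneg_left h4 (show 0 ≤ 1 + C by linarith)
        rw [pow_succ]
        linarith
    · refine ⟨L, h1, h2, Or.inr h3, h4.trans ?_⟩
      have e1 := sub_nonneg.2 (hmono (show b ≤ b + l by omega))
      have e2 : (1 + C) ^ p ≤ (1 + C) ^ (p + 1) := pow_le_pow_right₀ (by linarith) (by omega)
      exact mul_le_mul_of_nonneg_right e2 e1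

lemma IsBlockUniform.reflect (hF : IsBlockUniform F C m) :
    IsBlockUniform (fun i => -F (m - i)) C m := by
  intro i j l hl hi hij hji hjl
  have := hF (m - (j + l)) (m - (i + l)) l hl (by omega) (by omega) (by omega) (by omega)
  rw [show m - (j + l) + l = m - j by ring, show m - (i + l) + l = m - i by ring] at this
  constructor <;> linarith [this.1, this.2]

/-- Three doublings to the right reach b + 8 * l, three more to the left reach b - 7 * l, unless an
end of the range is met before. -/
lemma IsBlockUniform.extend (hF : IsBlockUniform F C m) (hC : 0 ≤ C) (hmono : Monotone F)
    {b l u v : ℤ} (hb : 0 ≤ b) (hl : 1 ≤ l) (hbl : b + l ≤ m) (hu : 0 ≤ u) (hv : v ≤ m)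
    (hbu : b ≤ u + 7 * l) (hvb : v ≤ b + 8 * l) :
    F v - F u ≤ (1 + C) ^ 6 * (F (b + l) - F b) := by
  obtain ⟨L, h1, h2, h3, h4⟩ := hF.extend_right hC hmono hb hl hbl 3
  have hmono' : Monotone fun i => -F (m - i) := fun x y hxy => by
    have := hmono (show m - y ≤ m - x by omega)
    show -F (m - x) ≤ -F (m - y)
    linarith
  obtain ⟨L', h1', h2', h3', h4'⟩ := hF.reflect.extend_right hC hmono' (b := m - (b + L)) (l := L)
    (by omega) (by omega) (by omega) 3
  rw [show m - (m - (b + L)) = b + L by ring, show m - (m - (b + L) + L) = b by ring] at h4'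
  have e1 := hmono (show v ≤ b + L by omega)
  have e2 := hmono (show m - (m - (b + L) + L') ≤ u by omega)
  have e3 := mul_le_mul_of_nonneg_left h4 (show 0 ≤ (1 + C) ^ 3 by positivity)
  have e4 : (1 + C) ^ 6 = (1 + C) ^ 3 * (1 + C) ^ 3 := by ring
  rw [e4]
  linarith

end Blocks

/-- Siblings are uniform, and ending and starting blocks of neighbouring components which are not
shorter than the gap between them have comparable masses. -/
structure IsBalanced (n : ℕ → ℕ) (c : ℕ → ℝ) (ν : Measure ℝ) (C : ℝ) : Prop where
  siblings : ∀ k e, 0 ≤ e → e < numComp n k →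
    IsBlockUniform (fun i => cumMass n c ν (k + 1) (e * n (k + 1) + i)) C (n (k + 1))
  cousins : ∀ k e (l : ℤ), 0 ≤ e → e + 1 < numComp n k → gapAfter n c k e < compLen n c k →
    1 ≤ l → l ≤ n (k + 1) → gapAfter n c k e < l * step n c (k + 1) + compLen n c (k + 1) →
    cumMass n c ν k (e + 1) - cumMass n c ν (k + 1) ((e + 1) * n (k + 1) - l) ≤
        C * (cumMass n c ν (k + 1) ((e + 1) * n (k + 1) + l) - cumMass n c ν k (e + 1)) ∧
      cumMass n c ν (k + 1) ((e + 1) * n (k + 1) + l) - cumMass n c ν k (e + 1) ≤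
        C * (cumMass n c ν k (e + 1) - cumMass n c ν (k + 1) ((e + 1) * n (k + 1) - l))

variable {ν : Measure ℝ} {C : ℝ}

lemma IsCarried.map_reflect (hν : IsCarried n c ν) (h : Admissible n c) :
    IsCarried n c (ν.map fun x => 1 - x) := by
  intro S hS hd
  rw [Measure.map_apply (by fun_prop) hS]
  refine hν _ ((by fun_prop : Measurable fun x : ℝ => 1 - x) hS) ?_
  exact Set.disjoint_left.2 fun x hx hxE => Set.disjoint_left.1 hd hx (h.one_sub_mem hxE)

variable [IsFiniteMeasure ν]

/-- For siblings this is uniformity with blocks of length 1. An inherited gap shorter than 2δ_k is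
shorter than the parent and than a step plus δ_k, so `cousins` applies with l = 1. Beyond the last
component the mass vanishes. -/
lemma IsBalanced.next_le (hB : IsBalanced n c ν C) (hC : 0 ≤ C) (hν : IsCarried n c ν)
    (h : Admissible n c) {k : ℕ} {e : ℤ} (h0 : 0 ≤ e)
    (hgap : gapAfter n c k e < 2 * compLen n c k) :
    cumMass n c ν k (e + 2) - cumMass n c ν k (e + 1) ≤
      C * (cumMass n c ν k (e + 1) - cumMass n c ν k e) := by
  by_cases h1 : numComp n k ≤ e + 1
  · rw [hν.real_block_zero h h1 (by omega)]
    exact mul_nonneg hC (sub_nonneg.2 (cumMass_mono h _ (by omega)))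
  cases k with
  | zero => simp at h1; omega
  | succ k =>
    obtain ⟨e', i, hi, hin, rfl⟩ := h.exists_child k e
    have hr := (h.child_mem_range hi hin).1 ⟨h0, by omega⟩
    by_cases hl : i + 1 < n (k + 1)
    · have := (hB.siblings k e' hr.1 hr.2 i (i + 1) 1 le_rfl hi (by omega) le_rfl (by omega)).2
      simpa only [add_assoc, one_add_one_eq_two] using this
    · have hi' : i = n (k + 1) - 1 := by omega
      have h2 := h.two_le_int k
      have h3 : e' * (n (k + 1) : ℤ) + i + 1 = (e' + 1) * n (k + 1) + 0 := by rw [hi']; ring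
      have hr' := (h.child_mem_range (k := k) (e := e' + 1) (i := 0) le_rfl (by omega)).1
        ⟨by omega, by omega⟩
      rw [hi', h.gapAfter_last] at hgap
      have := (hB.cousins k e' 1 hr.1 hr'.2 (by linarith [h.two_mul_compLen_succ_le k]) le_rfl
        (by omega) (by push_cast; linarith [h.compLen_lt_step k])).2
      rw [show e' * (n (k + 1) : ℤ) + i + 2 = (e' + 1) * n (k + 1) + 1 by rw [hi']; ring,
        show e' * (n (k + 1) : ℤ) + i = (e' + 1) * n (k + 1) - 1 by rw [hi']; ring,
        sub_add_cancel, cumMass_mul h]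
      exact this

lemma three_terms_le {C M M₁ M₂ : ℝ} (hC : 0 ≤ C) (hM : 0 ≤ M) (h₁ : M₁ ≤ C * M)
    (h₂ : M₂ ≤ C * M₁) : M + M₁ + M₂ ≤ (1 + C) ^ 2 * M := by
  nlinarith [mul_le_mul_of_nonneg_left h₁ hC, mul_nonneg hC hM]

set_option maxHeartbeats 400000 in
/-- One half of the doubling estimate. -/
lemma IsBalanced.right_half_le (hB : IsBalanced n c ν C) (hC : 0 ≤ C) (hν : IsCarried n c ν)
    (h : Admissible n c) {k : ℕ} {x r : ℝ} (hx : x ∈ cantorPoints n c)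
    (hr1 : compLen n c (k + 1) < r) (hr2 : r ≤ compLen n c k) :
    ν.real (Ico x (x + 2 * r)) ≤ (1 + C) ^ 8 * ν.real (Metric.ball x r) := by
  obtain ⟨e, he0, he1, hxe1, hxe2⟩ := hx k
  obtain ⟨i, hi, hin, hxi1, hxi2⟩ := h.exists_child_of_mem hx hxe1 hxe2
  have hs0 := h.step_pos (k := k + 1) (by omega)
  have hδs := h.compLen_lt_step k
  have hδ0 := h.compLen_pos (k + 1)
  have hδk := h.compLen_eq k
  have hδk0 := h.compLen_pos k
  have hn2 := h.two_le_int k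
  have hsucc := h.compPos_succ k e
  have hsucc2 := h.compPos_succ k (e + 1)
  have hsucc3 := h.compPos_succ k (e + 1 + 1)
  rw [show e + 1 + 1 = e + 2 by ring] at hsucc2 hsucc3
  rw [show e + 2 + 1 = e + 3 by ring] at hsucc3
  have hg0 := h.gapAfter_pos k e
  have hg1 := h.gapAfter_pos k (e + 1)
  have hg2 := h.gapAfter_pos k (e + 2)
  -- A row of l siblings is shorter than r, a row of l + 1 is not.
  obtain ⟨l, hl1, hl2, hl3⟩ : ∃ l : ℤ, 1 ≤ l ∧
      ((l : ℝ) - 1) * step n c (k + 1) + compLen n c (k + 1) < r ∧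
      r ≤ l * step n c (k + 1) + compLen n c (k + 1) := by
    have h1 := Int.ceil_lt_add_one ((r - compLen n c (k + 1)) / step n c (k + 1))
    have h2 := Int.le_ceil ((r - compLen n c (k + 1)) / step n c (k + 1))
    refine ⟨⌈(r - compLen n c (k + 1)) / step n c (k + 1)⌉, ?_, ?_, ?_⟩
    · rw [Int.one_le_ceil_iff]
      exact div_pos (by linarith) hs0
    · rw [← sub_lt_iff_lt_add, lt_div_iff₀ hs0] at h1
      linarith
    · rw [div_le_iff₀ hs0] at h2
      linarith
  obtain ⟨l', hl'⟩ : ∃ l', l' = min l (n (k + 1) : ℤ) := ⟨_, rfl⟩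
  -- The block is moved left just enough to fit into the parent. It contains the child i around x,
  -- hence lies in B(x, r).
  obtain ⟨b, hb⟩ : ∃ b, b = min i (n (k + 1) - l') := ⟨_, rfl⟩
  have hl1' : (1 : ℝ) ≤ l := by exact_mod_cast hl1
  set B := cumMass n c ν (k + 1) (e * n (k + 1) + (b + l')) -
    cumMass n c ν (k + 1) (e * n (k + 1) + b) with hBdef
  have hB0 : 0 ≤ B := sub_nonneg.2 (cumMass_mono h _ (by omega))
  have hBball : B ≤ ν.real (Metric.ball x r) := by
    refine hν.block_le h (by omega) Metric.isOpen_ball.measurableSet fun y _ hy1 hy2 => ?_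
    rw [show e * (n (k + 1) : ℤ) + (b + l') - 1 = e * n (k + 1) + (b + l' - 1) by ring,
      h.compPos_child k e _ (by omega) (by omega)] at hy2
    rw [h.compPos_child k e _ (by omega) (by omega)] at hy1
    push_cast at hy2
    have f1 : (b : ℝ) + l' - 1 ≤ i + (l - 1) := by
      exact_mod_cast (show b + l' - 1 ≤ i + (l - 1) by omega)
    have f2 : (i : ℝ) ≤ b + (l - 1) := by exact_mod_cast (show i ≤ b + (l - 1) by omega)
    have f3 := mul_le_mul_of_nonneg_right f1 hs0.le
    have f4 := mul_le_mul_of_nonneg_right f2 hs0.le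
    rw [Metric.mem_ball, Real.dist_eq, abs_lt]
    constructor <;> linarith
  have hF := hB.siblings k e he0 he1
  have hFmono : Monotone fun i => cumMass n c ν (k + 1) (e * n (k + 1) + i) := fun u v huv =>
    cumMass_mono h (k + 1) (by omega)
  have hU : ∀ u v : ℤ, 0 ≤ u → v ≤ n (k + 1) → b ≤ u + 7 * l' → v ≤ b + 8 * l' →
      cumMass n c ν (k + 1) (e * n (k + 1) + v) - cumMass n c ν (k + 1) (e * n (k + 1) + u) ≤
        (1 + C) ^ 6 * B := fun u v hu hv h1 h2 =>
    hF.extend hC hFmono (by omega) (by omega) (by omega) hu hv h1 h2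
  have hen : e * (n (k + 1) : ℤ) + n (k + 1) = (e + 1) * n (k + 1) := by ring
  suffices hmain : ν.real (Ico x (x + 2 * r)) ≤ (1 + C) ^ 2 * ((1 + C) ^ 6 * B) by
    have e1 := mul_le_mul_of_nonneg_left hBball (show 0 ≤ (1 + C) ^ 8 by positivity)
    calc _ ≤ _ := hmain
      _ = (1 + C) ^ 8 * B := by ring
      _ ≤ _ := e1
  have hB6 : 0 ≤ (1 + C) ^ 6 * B := by positivity
  -- If 2r > δ_k, the parent has at most 2l + 1 children, so the block controls all of it. The
  -- interval [x, x + 2r) meets at most three components of level k, and every gap it crosses is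
  -- shorter than 2r ≤ 2δ_k, as `next_le` requires.
  by_cases hbig : compLen n c k < 2 * r
  · have hn : (n (k + 1) : ℤ) < 2 * l + 2 := by
      have : ((n (k + 1) : ℝ) - 1) * step n c (k + 1) < (2 * l + 1) * step n c (k + 1) := by
        linarith
      have := lt_of_mul_lt_mul_right this hs0.le
      have : (n (k + 1) : ℝ) < 2 * l + 2 := by linarith
      exact_mod_cast this
    have hMe := hU 0 (n (k + 1)) le_rfl le_rfl (by omega) (by omega)
    rw [add_zero, hen, cumMass_mul h, cumMass_mul h] at hMe
    have hM0 : 0 ≤ cumMass n c ν k (e + 1) - cumMass n c ν k e :=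
      sub_nonneg.2 (cumMass_mono h _ (by omega))
    refine le_trans ?_ (mul_le_mul_of_nonneg_left hMe (by positivity))
    have hCM := mul_nonneg hC hM0
    by_cases hc1 : 2 * r ≤ gapAfter n c k e
    · have := hν.le_block h (show e ≤ e + 1 by omega) (measurableSet_Ico (a := x) (b := x + 2 * r))
        (k := k) (fun y _ hy => ⟨by linarith [hy.1], by linarith [hy.2]⟩)
      linarith [three_terms_le hC hM0 (M₁ := 0) hCM (M₂ := 0) (by simp)]
    have hn1 := hB.next_le hC hν h he0 (k := k) (by linarith)
    by_cases hc2 : 2 * r ≤ gapAfter n c k e + compLen n c k + gapAfter n c k (e + 1)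
    · have := hν.le_block h (show e ≤ e + 2 by omega) (measurableSet_Ico (a := x) (b := x + 2 * r))
        (k := k) (fun y _ hy => ⟨by linarith [hy.1], by linarith [hy.2]⟩)
      linarith [three_terms_le hC hM0 hn1 (M₂ := 0)
        (mul_nonneg hC (sub_nonneg.2 (cumMass_mono h _ (by omega))))]
    have hn2 := hB.next_le hC hν h (show 0 ≤ e + 1 by omega) (k := k) (by linarith)
    rw [show e + 1 + 2 = e + 3 by ring, show e + 1 + 1 = e + 2 by ring] at hn2
    have := hν.le_block h (show e ≤ e + 3 by omega) (measurableSet_Ico (a := x) (b := x + 2 * r))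
        (k := k) (fun y _ hy => ⟨by linarith [hy.1], by linarith [hy.2]⟩)
    linarith [three_terms_le hC hM0 hn1 hn2]
  · rw [not_lt] at hbig
    have hC1 : 1 + C ≤ (1 + C) ^ 2 := by nlinarith
    have hT1 : ν.real (Ico x (min (x + 2 * r) (compPos n c k (e + 1)))) ≤ (1 + C) ^ 6 * B := by
      refine le_trans ?_ (hU i (min (n (k + 1)) (i + 2 * l + 3)) hi (by omega) (by omega)
        (by omega))
      refine hν.le_block h (by omega) measurableSet_Ico fun y _ hy => ?_
      rw [mem_Ico, lt_min_iff] at hy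
      refine ⟨by rw [h.compPos_child k e i hi hin]; linarith, ?_⟩
      by_cases hv : (n (k + 1) : ℤ) ≤ i + 2 * l + 3
      · rw [min_eq_left hv, hen, h.compPos_mul]
        exact hy.2.2
      · rw [min_eq_right (by omega), h.compPos_child k e _ (by omega) (by omega)]
        push_cast
        linarith
    by_cases hc1 : x + 2 * r ≤ compPos n c k (e + 1)
    · rw [min_eq_left hc1] at hT1
      nlinarith
    rw [not_le] at hc1
    rw [min_eq_right hc1.le] at hT1
    have hT2 : ν.real (Ico (compPos n c k (e + 1)) (x + 2 * r)) ≤ C * ((1 + C) ^ 6 * B) := by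
      by_cases hlast : numComp n k ≤ e + 1
      · have h1 := hν.le_block h (show e + 1 ≤ e + 2 by omega) (measurableSet_Ico
          (a := compPos n c k (e + 1)) (b := x + 2 * r)) (k := k)
          (fun y _ hy => ⟨hy.1, by linarith [hy.2]⟩)
        rw [hν.real_block_zero h hlast (by omega)] at h1
        exact h1.trans (mul_nonneg hC hB6)
      have hni : (n (k + 1) : ℤ) < i + 2 * l + 3 := by
        have h1 : ((n (k + 1) : ℝ)) * step n c (k + 1) < (i + 2 * l + 3) * step n c (k + 1) := by
          linarith
        have h2 := lt_of_mul_lt_mul_right h1 hs0.le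
        exact_mod_cast h2
      -- The gap is shorter than 2r, which is at most 2 (l steps + δ_{k+1}) and at most δ_k; either
      -- value of the minimum thus meets the requirement of `cousins`. The first L children of the
      -- next component cover the rest of [x, x + 2r).
      obtain ⟨L, hL⟩ : ∃ L, L = min (4 * l) (n (k + 1) : ℤ) := ⟨_, rfl⟩
      have hgL : gapAfter n c k e < L * step n c (k + 1) + compLen n c (k + 1) := by
        rcases min_choice (4 * l) (n (k + 1) : ℤ) with hm | hm
        · rw [hL, hm]; push_cast; nlinarith
        · rw [hL, hm]; push_cast; nlinarith
      have h1 := (hB.cousins k e L he0 (by omega) (by linarith) (by omega) (by omega) hgL).2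
      have h2 := hU (n (k + 1) - L) (n (k + 1)) (by omega) le_rfl (by omega) (by omega)
      rw [hen, cumMass_mul h, show e * (n (k + 1) : ℤ) + (n (k + 1) - L) =
        (e + 1) * n (k + 1) - L by ring] at h2
      refine le_trans ?_ (h1.trans (mul_le_mul_of_nonneg_left h2 hC))
      rw [← cumMass_mul h k (e + 1)]
      refine hν.le_block h (by omega) measurableSet_Ico fun y _ hy => ?_
      rw [h.compPos_mul]
      refine ⟨hy.1, ?_⟩
      by_cases hm : 4 * l < (n (k + 1) : ℤ)
      · rw [hL, min_eq_left hm.le, h.compPos_child k (e + 1) _ (by omega) hm]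
        push_cast
        have := hy.2
        nlinarith
      · rw [hL, min_eq_right (by omega), show (e + 1) * (n (k + 1) : ℤ) + n (k + 1) =
          (e + 2) * n (k + 1) by ring, h.compPos_mul]
        linarith [hy.2]
    have hunion : ν.real (Ico x (x + 2 * r)) ≤ ν.real (Ico x (compPos n c k (e + 1))) +
        ν.real (Ico (compPos n c k (e + 1)) (x + 2 * r)) := by
      refine (measureReal_mono ?_).trans (measureReal_union_le _ _)
      exact fun y hy => by
        rcases lt_or_ge y (compPos n c k (e + 1)) with hh | hh
        · exact Or.inl ⟨hy.1, hh⟩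
        · exact Or.inr ⟨hh, hy.2⟩
    have := mul_le_mul_of_nonneg_right hC1 hB6
    linarith


lemma IsCarried.cumMass_map_reflect (hν : IsCarried n c ν) (h : Admissible n c) (k : ℕ) (a : ℤ) :
    cumMass n c (ν.map fun x => 1 - x) k a =
      ν.real univ - cumMass n c ν k (numComp n k - a) := by
  unfold cumMass
  rw [map_measureReal_apply (by fun_prop) measurableSet_Iio]
  have h1 : ν.real univ - ν.real (Iio (compPos n c k (numComp n k - a))) =
      ν.real (Ici (compPos n c k (numComp n k - a))) := by
    rw [← measureReal_compl measurableSet_Iio, compl_Iio]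
  rw [h1]
  have h2 := h.one_sub_compPos k a
  have h3 := h.compPos_add_compLen_lt (k := k) (show numComp n k - 1 - a < numComp n k - a by omega)
  refine le_antisymm ?_ ?_
  · refine hν.real_mono ((by fun_prop : Measurable fun x : ℝ => 1 - x) measurableSet_Iio)
      measurableSet_Ici fun x hx hxS => ?_
    rw [mem_preimage, mem_Iio] at hxS
    have := h.ge_of_compPos_add_lt (k := k) (a := numComp n k - 1 - a) hx (by linarith)
    rwa [show numComp n k - 1 - a + 1 = numComp n k - a by ring] at this
  · refine hν.real_mono measurableSet_Ici
      ((by fun_prop : Measurable fun x : ℝ => 1 - x) measurableSet_Iio) fun x hx hxS => ?_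
    rw [mem_preimage, mem_Iio]
    rw [mem_Ici] at hxS
    linarith

/-- Reversing the order exchanges the two blocks in each comparison. This carries the estimate for
right halves of balls over to left halves. -/
lemma IsBalanced.map_reflect (hB : IsBalanced n c ν C) (hν : IsCarried n c ν)
    (h : Admissible n c) : IsBalanced n c (ν.map fun x => 1 - x) C := by
  constructor
  · intro k e he0 he1
    have := (hB.siblings k (numComp n k - 1 - e) (by omega) (by omega)).reflect
    intro i j l hl hi hij hji hjl
    have h1 := this i j l hl hi hij hji hjl
    have h2 : ∀ t : ℤ, numComp n (k + 1) - (e * n (k + 1) + t) =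
        (numComp n k - 1 - e) * n (k + 1) + (n (k + 1) - t) := fun t => by
      rw [numComp_succ]; ring
    simp only [hν.cumMass_map_reflect h, h2]
    constructor <;> linarith [h1.1, h1.2]
  · intro k e l he0 he1 hg hl hln hgl
    have h1 := hB.cousins k (numComp n k - 2 - e) l (by omega) (by omega)
      (by rwa [h.gapAfter_reflect]) hl hln (by rwa [h.gapAfter_reflect])
    have h2 : numComp n (k + 1) - ((e + 1) * n (k + 1) - l) =
        (numComp n k - 2 - e + 1) * n (k + 1) + l := by rw [numComp_succ]; ring
    have h3 : numComp n (k + 1) - ((e + 1) * n (k + 1) + l) =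
        (numComp n k - 2 - e + 1) * n (k + 1) - l := by rw [numComp_succ]; ring
    have h4 : numComp n k - (e + 1) = numComp n k - 2 - e + 1 := by ring
    simp only [hν.cumMass_map_reflect h, h2, h3, h4]
    constructor <;> linarith [h1.1, h1.2]

lemma IsBalanced.isDoublingOn (hB : IsBalanced n c ν C) (hC : 0 ≤ C) (hν : IsCarried n c ν)
    (h : Admissible n c) : IsDoublingOn n c ν (2 * (1 + C) ^ 8) := by
  intro x hx r hr
  have hC8 : (1 : ℝ) ≤ (1 + C) ^ 8 := one_le_pow₀ (by linarith)
  by_cases hr1 : 1 < r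
  · have h1 : ν.real (Metric.ball x (2 * r)) ≤ ν.real (Metric.ball x r) := by
      refine hν.real_mono Metric.isOpen_ball.measurableSet Metric.isOpen_ball.measurableSet
        fun y hy _ => ?_
      obtain ⟨a, ha0, ha1, ha2, ha3⟩ := hx 0
      obtain ⟨b, hb0, hb1, hb2, hb3⟩ := hy 0
      simp only [numComp_zero] at ha1 hb1
      obtain rfl : a = 0 := by omega
      obtain rfl : b = 0 := by omega
      simp only [compPos, compLen_zero] at ha2 ha3 hb2 hb3
      norm_num at ha2 ha3 hb2 hb3
      rw [Metric.mem_ball, Real.dist_eq, abs_lt]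
      constructor <;> linarith
    have h2 : 0 ≤ ν.real (Metric.ball x r) := measureReal_nonneg
    nlinarith
  · rw [not_lt] at hr1
    have hex : ∃ k, compLen n c k < r := (h.compLen_tendsto.eventually_lt_const hr).exists
    classical
    obtain ⟨k, hk⟩ : ∃ k, Nat.find hex = k + 1 := by
      refine Nat.exists_eq_succ_of_ne_zero fun h0 => ?_
      have := Nat.find_spec hex
      rw [h0, compLen_zero] at this
      linarith
    have hk1 := Nat.find_spec hex
    have hk2 := Nat.find_min hex (m := k) (by omega)
    rw [hk] at hk1
    rw [not_lt] at hk2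
    have hR := hB.right_half_le hC hν h hx hk1 hk2
    have hL := (hB.map_reflect hν h).right_half_le hC (hν.map_reflect h) h (h.one_sub_mem hx)
      hk1 hk2
    rw [map_measureReal_apply (by fun_prop) measurableSet_Ico,
      map_measureReal_apply (by fun_prop) Metric.isOpen_ball.measurableSet] at hL
    have e1 : (fun y : ℝ => 1 - y) ⁻¹' Metric.ball (1 - x) r = Metric.ball x r := by
      ext y
      simp only [mem_preimage, Metric.mem_ball, Real.dist_eq]
      rw [show 1 - y - (1 - x) = -(y - x) by ring, abs_neg]
    rw [e1] at hL
    have e2 : ν.real (Metric.ball x (2 * r)) ≤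
        ν.real ((fun y : ℝ => 1 - y) ⁻¹' Ico (1 - x) (1 - x + 2 * r)) +
          ν.real (Ico x (x + 2 * r)) := by
      refine (measureReal_mono fun y hy => ?_).trans (measureReal_union_le _ _)
      rw [Metric.mem_ball, Real.dist_eq, abs_lt] at hy
      rcases le_total x y with hxy | hxy
      · exact Or.inr ⟨hxy, by linarith⟩
      · exact Or.inl ⟨by linarith, by linarith⟩
    linarith

end

/-! ### Words, their indices and their extensions -/

section

/-- The index of the component of level `k` labelled by the first `k` letters of the word
`d 0, d 1, …`. -/
def digitIndex (n : ℕ → ℕ) (d : ℕ → ℕ) : ℕ → ℤ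
  | 0 => 0
  | k + 1 => digitIndex n d k * n (k + 1) + ((d k : ℤ) - 1)

/-- The index of the component labelled by a word. -/
def wordIndex (n : ℕ → ℕ) (w : List ℕ) : ℤ := digitIndex n (fun j => w.getD j 0) w.length

lemma digitIndex_congr {d d' : ℕ → ℕ} {k : ℕ} (hd : ∀ j < k, d j = d' j) :
    digitIndex n d k = digitIndex n d' k := by
  induction k with
  | zero => rfl
  | succ k ih => simp only [digitIndex, ih fun j hj => hd j (by omega), hd k (by omega)]

lemma getD_concat_of_lt {w : List ℕ} {i j : ℕ} (hj : j < w.length) :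
    (w ++ [i]).getD j 0 = w.getD j 0 := List.getD_append _ _ _ _ hj

lemma getD_concat_length {w : List ℕ} {i : ℕ} : (w ++ [i]).getD w.length 0 = i := by
  simp

@[simp] lemma wordIndex_nil : wordIndex n [] = 0 := rfl

lemma wordIndex_concat (w : List ℕ) (i : ℕ) :
    wordIndex n (w ++ [i]) = wordIndex n w * n (w.length + 1) + ((i : ℤ) - 1) := by
  unfold wordIndex
  rw [List.length_append, List.length_singleton, digitIndex, getD_concat_length,
    digitIndex_congr fun j hj => getD_concat_of_lt hj]

lemma isWord_nil : IsWord n [] := fun j hj => absurd hj (by simp)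

lemma isWord_concat {w : List ℕ} {i : ℕ} :
    IsWord n (w ++ [i]) ↔ IsWord n w ∧ 1 ≤ i ∧ i ≤ n (w.length + 1) := by
  unfold IsWord
  constructor
  · intro hw
    refine ⟨fun j hj => ?_, ?_⟩
    · have := hw j (by simp; omega)
      rwa [getD_concat_of_lt hj] at this
    · have := hw w.length (by simp)
      rwa [getD_concat_length] at this
  · rintro ⟨hw, hi⟩ j hj
    rw [List.length_append, List.length_singleton] at hj
    rcases Nat.lt_succ_iff_lt_or_eq.1 hj with hj | rfl
    · rw [getD_concat_of_lt hj]
      exact hw j hj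
    · rwa [getD_concat_length]

lemma leftEnd_concat (w : List ℕ) (i : ℕ) :
    leftEnd n c (w ++ [i]) = leftEnd n c w + ((i : ℝ) - 1) * step n c (w.length + 1) := by
  unfold leftEnd
  rw [List.length_append, List.length_singleton, Finset.sum_range_succ, getD_concat_length]
  congr 1
  exact Finset.sum_congr rfl fun j hj => by rw [getD_concat_of_lt (Finset.mem_range.1 hj)]

namespace Admissible

lemma wordIndex_mem (h : Admissible n c) {w : List ℕ} (hw : IsWord n w) :
    0 ≤ wordIndex n w ∧ wordIndex n w < numComp n w.length := by
  induction w using List.reverseRecOn with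
  | nil => simp
  | append_singleton w i ih =>
    rw [isWord_concat] at hw
    rw [wordIndex_concat, List.length_append, List.length_singleton]
    exact (h.child_mem_range (by omega) (by omega)).2 (ih hw.1)

lemma leftEnd_eq (h : Admissible n c) {w : List ℕ} (hw : IsWord n w) :
    leftEnd n c w = compPos n c w.length (wordIndex n w) := by
  induction w using List.reverseRecOn with
  | nil => simp [leftEnd, compPos]
  | append_singleton w i ih =>
    rw [isWord_concat] at hw
    rw [leftEnd_concat, wordIndex_concat, List.length_append, List.length_singleton,
      h.compPos_child _ _ _ (by omega) (by omega), ih hw.1]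
    push_cast
    rfl

lemma exists_word (h : Admissible n c) (k : ℕ) {a : ℤ} (h0 : 0 ≤ a) (h1 : a < numComp n k) :
    ∃ w, IsWord n w ∧ w.length = k ∧ wordIndex n w = a := by
  induction k generalizing a with
  | zero =>
    simp only [numComp_zero] at h1
    exact ⟨[], isWord_nil, rfl, by rw [wordIndex_nil]; omega⟩
  | succ k ih =>
    obtain ⟨e, i, hi, hin, rfl⟩ := h.exists_child k a
    have hr := (h.child_mem_range hi hin).1 ⟨h0, h1⟩
    obtain ⟨w, hw, rfl, rfl⟩ := ih hr.1 hr.2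
    refine ⟨w ++ [i.toNat + 1], isWord_concat.2 ⟨hw, by omega, by omega⟩, by simp, ?_⟩
    rw [wordIndex_concat]
    congr 1
    omega

lemma cantorSet_eq (h : Admissible n c) : cantorSet n c = cantorPoints n c := by
  ext x
  unfold cantorSet levelSet cantorPoints component
  simp only [mem_iInter, mem_iUnion, mem_ofPred_eq, exists_prop]
  refine forall_congr' fun k => ⟨?_, ?_⟩
  · rintro ⟨w, ⟨hw, rfl⟩, hx⟩
    rw [h.leftEnd_eq hw] at hx
    have := h.wordIndex_mem hw
    exact ⟨_, this.1, this.2, hx.1, hx.2⟩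
  · rintro ⟨a, h0, h1, hx⟩
    obtain ⟨w, hw, rfl, rfl⟩ := h.exists_word k h0 h1
    refine ⟨w, ⟨hw, rfl⟩, ?_⟩
    rw [h.leftEnd_eq hw]
    exact hx

end Admissible

section Extensions

lemma maxExt_zero (v : List ℕ) : maxExt n v 0 = v := by simp [maxExt]

lemma maxExt_succ (v : List ℕ) (t : ℕ) :
    maxExt n v (t + 1) = maxExt n v t ++ [n (v.length + 1 + t)] := by
  simp [maxExt, List.range_succ]

lemma length_maxExt (v : List ℕ) (t : ℕ) : (maxExt n v t).length = v.length + t := by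
  simp [maxExt]

lemma minExt_zero (v : List ℕ) : minExt v 0 = v := by simp [minExt]

lemma minExt_succ (v : List ℕ) (t : ℕ) : minExt v (t + 1) = minExt v t ++ [1] := by
  simp [minExt, List.replicate_succ']

lemma length_minExt (v : List ℕ) (t : ℕ) : (minExt v t).length = v.length + t := by
  simp [minExt]

lemma Admissible.isWord_maxExt (h : Admissible n c) {v : List ℕ} (hv : IsWord n v) (t : ℕ) :
    IsWord n (maxExt n v t) := by
  induction t with
  | zero => rwa [maxExt_zero]
  | succ t ih =>
    have := h.two_le (v.length + t + 1) (by omega)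
    rw [maxExt_succ, isWord_concat, length_maxExt, show v.length + 1 + t = v.length + t + 1 by ring]
    exact ⟨ih, by omega, le_rfl⟩

lemma Admissible.isWord_minExt (h : Admissible n c) {v : List ℕ} (hv : IsWord n v) (t : ℕ) :
    IsWord n (minExt v t) := by
  induction t with
  | zero => rwa [minExt_zero]
  | succ t ih =>
    have := h.two_le (v.length + t + 1) (by omega)
    rw [minExt_succ, isWord_concat, length_minExt]
    exact ⟨ih, le_rfl, by omega⟩

/-- The maximal extension of `wi` and the minimal extension of `w(i+1)` label neighbours. -/
lemma wordIndex_minExt (w : List ℕ) (i t : ℕ) :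
    wordIndex n (minExt (w ++ [i + 1]) t) = wordIndex n (maxExt n (w ++ [i]) t) + 1 := by
  induction t with
  | zero =>
    rw [minExt_zero, maxExt_zero, wordIndex_concat, wordIndex_concat]
    push_cast
    ring
  | succ t ih =>
    rw [minExt_succ, maxExt_succ, wordIndex_concat, wordIndex_concat, ih, length_maxExt,
      length_minExt]
    simp only [List.length_append, List.length_singleton]
    rw [show w.length + 1 + 1 + t = w.length + 1 + t + 1 by ring]
    push_cast
    ring

/-- Appending maximal letters keeps the right endpoint, so the gap created after wi is still the one
that follows all these extensions. -/
lemma Admissible.gapAfter_maxExt (h : Admissible n c) (w : List ℕ) {i : ℕ} (hi : 1 ≤ i)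
    (hin : i < n (w.length + 1)) (t : ℕ) :
    gapAfter n c (w.length + 1 + t) (wordIndex n (maxExt n (w ++ [i]) t)) =
      gapLen n c (w.length + 1) := by
  induction t with
  | zero =>
    rw [maxExt_zero, wordIndex_concat]
    exact h.gapAfter_sibling w.length _ _ (by omega) (by omega)
  | succ t ih =>
    rw [maxExt_succ, wordIndex_concat, length_maxExt]
    simp only [List.length_append, List.length_singleton]
    rw [show w.length + 1 + 1 + t = w.length + 1 + t + 1 by ring]
    have := h.gapAfter_last (w.length + 1 + t) (wordIndex n (maxExt n (w ++ [i]) t))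
    rw [← add_assoc, this, ih]

/-- Every pair of neighbours is labelled by a maximal and a minimal extension. -/
lemma Admissible.exists_maxExt (h : Admissible n c) (k : ℕ) {e : ℤ} (h0 : 0 ≤ e)
    (h1 : e + 1 < numComp n k) :
    ∃ w i t, IsWord n w ∧ 1 ≤ i ∧ i < n (w.length + 1) ∧ w.length + 1 + t = k ∧
      wordIndex n (maxExt n (w ++ [i]) t) = e := by
  induction k generalizing e with
  | zero => simp at h1; omega
  | succ k ih =>
    obtain ⟨e', i, hi, hin, rfl⟩ := h.exists_child k e
    by_cases hl : i + 1 < n (k + 1)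
    · have hr := (h.child_mem_range hi hin).1 ⟨h0, by omega⟩
      obtain ⟨w, hw, rfl, rfl⟩ := h.exists_word k hr.1 hr.2
      refine ⟨w, i.toNat + 1, 0, hw, by omega, by omega, rfl, ?_⟩
      rw [maxExt_zero, wordIndex_concat]
      congr 1
      omega
    -- A last child is followed by the first child of the next parent, and the induction hypothesis
    -- labels the pair of parents.
    · have h2 := h.two_le_int k
      have hr := (h.child_mem_range hi hin).1 ⟨h0, by omega⟩
      have h3 : e' * (n (k + 1) : ℤ) + i + 1 = (e' + 1) * n (k + 1) + 0 := by
        rw [show i = n (k + 1) - 1 by omega]; ring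
      have hr' := (h.child_mem_range (k := k) (e := e' + 1) (i := 0) le_rfl (by omega)).1
        ⟨by omega, by omega⟩
      obtain ⟨w, j, t, hw, hj, hjn, rfl, rfl⟩ := ih hr.1 hr'.2
      refine ⟨w, j, t + 1, hw, hj, hjn, rfl, ?_⟩
      rw [maxExt_succ, wordIndex_concat, length_maxExt]
      simp only [List.length_append, List.length_singleton]
      rw [show w.length + 1 + 1 + t = w.length + 1 + t + 1 by ring]
      congr 1
      omega

end Extensions

/-! ### Uniform vectors and increments of a cumulative function -/

section Lists

variable {P : List ℝ} {G : ℕ → ℝ} {lo hi C C' : ℝ} {s : ℕ}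

lemma blockSum_bounds {i l : ℕ} (hil : i + l ≤ P.length)
    (hP : ∀ a < P.length, lo * (G (a + 1) - G a) ≤ P.getD a 0 ∧
      P.getD a 0 ≤ hi * (G (a + 1) - G a)) :
    lo * (G (i + l) - G i) ≤ blockSum P i l ∧ blockSum P i l ≤ hi * (G (i + l) - G i) := by
  induction l with
  | zero => simp [blockSum]
  | succ l ih =>
    have h1 := ih (by omega)
    have h2 := hP (i + l) (by omega)
    unfold blockSum at h1 ⊢
    rw [Finset.sum_range_succ, ← add_assoc]
    constructor <;> linarith [h1.1, h1.2, h2.1, h2.2]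

/-- The entries are increments of `G` up to factors between `lo` and `hi`, because the halves of a
concatenated vector have different normalisations. Ratios of block sums change by at most `hi / lo`.
-/
lemma isUniformFrom_of_blocks (hs : 1 ≤ s) (hlo : 0 < lo) (hC' : 0 < C') (hhi : 0 ≤ hi)
    (hP : ∀ a < P.length, lo * (G (a + 1) - G a) ≤ P.getD a 0 ∧
      P.getD a 0 ≤ hi * (G (a + 1) - G a))
    (hG : ∀ i l, 1 ≤ l → i + l ≤ P.length → G i < G (i + l))
    (hblk : ∀ i j l : ℕ, s ≤ l → i ≤ j → j ≤ i + l → j + l ≤ P.length →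
      G (i + l) - G i ≤ C * (G (j + l) - G j) ∧ G (j + l) - G j ≤ C * (G (i + l) - G i))
    (hC : hi * C ≤ C' * lo) : IsUniformFrom C' s P := by
  intro i j l hl hij hji hjl
  have h1 := blockSum_bounds (i := i) (l := l) (by omega) hP
  have h2 := blockSum_bounds hjl hP
  have p1 := hG i l (by omega) (by omega)
  have p2 := hG j l (by omega) hjl
  have h3 := hblk i j l hl hij hji hjl
  have q1 : 0 < lo * (G (i + l) - G i) := mul_pos hlo (by linarith)
  have q2 : 0 < lo * (G (j + l) - G j) := mul_pos hlo (by linarith)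
  have key : ∀ {X Y x y : ℝ}, 0 < Y → x ≤ hi * X → X ≤ C * Y → lo * Y ≤ y → x ≤ C' * y := by
    intro X Y x y hY hx hXY hy
    calc x ≤ hi * X := hx
      _ ≤ hi * (C * Y) := mul_le_mul_of_nonneg_left hXY hhi
      _ = (hi * C) * Y := by ring
      _ ≤ (C' * lo) * Y := mul_le_mul_of_nonneg_right hC hY.le
      _ = C' * (lo * Y) := by ring
      _ ≤ C' * y := mul_le_mul_of_nonneg_left hy hC'.le
  have b1 := key (by linarith) h1.2 h3.1 h2.1
  have b2 := key (by linarith) h2.2 h3.2 h1.1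
  constructor
  · rw [le_div_iff₀ (by linarith [h2.1]), inv_mul_le_iff₀ hC']
    exact b2
  · rw [div_le_iff₀ (by linarith [h2.1])]
    exact b1

lemma blocks_of_isUniformFrom (hs : 1 ≤ s) (hlo : 0 < lo) (hC : 0 < C)
    (hP : ∀ a < P.length, lo * (G (a + 1) - G a) ≤ P.getD a 0 ∧
      P.getD a 0 ≤ hi * (G (a + 1) - G a))
    (hG : ∀ i l, 1 ≤ l → i + l ≤ P.length → G i < G (i + l))
    (hU : IsUniformFrom C s P) (hC' : C * hi ≤ C' * lo) {i j l : ℕ} (hl : s ≤ l) (hij : i ≤ j)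
    (hji : j ≤ i + l) (hjl : j + l ≤ P.length) :
    G (i + l) - G i ≤ C' * (G (j + l) - G j) ∧ G (j + l) - G j ≤ C' * (G (i + l) - G i) := by
  have h1 := blockSum_bounds (i := i) (l := l) (by omega) hP
  have h2 := blockSum_bounds hjl hP
  have p1 := hG i l (by omega) (by omega)
  have p2 := hG j l (by omega) hjl
  obtain ⟨u1, u2⟩ := hU i j l hl hij hji hjl
  have q2 : 0 < lo * (G (j + l) - G j) := mul_pos hlo (by linarith)
  rw [le_div_iff₀ (by linarith [h2.1]), inv_mul_le_iff₀ hC] at u1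
  rw [div_le_iff₀ (by linarith [h2.1])] at u2
  have key : ∀ {X Y x y : ℝ}, 0 < Y → lo * X ≤ x → x ≤ C * y → y ≤ hi * Y → X ≤ C' * Y := by
    intro X Y x y hY hx hxy hy
    refine le_of_mul_le_mul_left ?_ hlo
    calc lo * X ≤ x := hx
      _ ≤ C * y := hxy
      _ ≤ C * (hi * Y) := mul_le_mul_of_nonneg_left hy hC.le
      _ = (C * hi) * Y := by ring
      _ ≤ (C' * lo) * Y := mul_le_mul_of_nonneg_right hC' hY.le
      _ = lo * (C' * Y) := by ring
  exact ⟨key (by linarith) h1.1 u2 h2.2, key (by linarith) h2.1 u1 h1.2⟩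

end Lists

/-! ### Transfer of the measure to the line -/

section Measure

/-- The measure on the line given by a measure on the Cantor set. -/
def lineMeasure (μ : Measure (cantorSet n c)) : Measure ℝ := μ.map Subtype.val

variable {μ : Measure (cantorSet n c)}

lemma Admissible.isCarried_lineMeasure (h : Admissible n c) : IsCarried n c (lineMeasure μ) := by
  intro S hS hd
  unfold lineMeasure
  rw [Measure.map_apply measurable_subtype_coe hS]
  have : (Subtype.val ⁻¹' S : Set (cantorSet n c)) = ∅ := by
    ext x
    simp only [mem_preimage, mem_empty_iff_false, iff_false]
    intro hx
    exact Set.disjoint_left.1 hd hx (h.cantorSet_eq ▸ x.2)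
  rw [this, measure_empty]

lemma lineMeasure_real_ball (x : cantorSet n c) (r : ℝ) :
    (lineMeasure μ).real (Metric.ball (x : ℝ) r) = μ.real (Metric.ball x r) := by
  unfold lineMeasure
  rw [map_measureReal_apply measurable_subtype_coe Metric.isOpen_ball.measurableSet]
  rfl

variable [IsProbabilityMeasure μ]

instance : IsFiniteMeasure (lineMeasure μ) := by unfold lineMeasure; infer_instance

lemma Admissible.mass_eq (h : Admissible n c) {w : List ℕ} (hw : IsWord n w) :
    mass μ w = cumMass n c (lineMeasure μ) w.length (wordIndex n w + 1) -
      cumMass n c (lineMeasure μ) w.length (wordIndex n w) := by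
  have hν : IsCarried n c (lineMeasure μ) := h.isCarried_lineMeasure
  have h1 : mass μ w = (lineMeasure μ).real (Icc (compPos n c w.length (wordIndex n w))
      (compPos n c w.length (wordIndex n w) + compLen n c w.length)) := by
    unfold lineMeasure
    rw [map_measureReal_apply measurable_subtype_coe measurableSet_Icc]
    unfold mass component
    rw [h.leftEnd_eq hw]
    rfl
  rw [h1]
  refine le_antisymm ?_ ?_
  · refine hν.le_block h (by omega) measurableSet_Icc fun y _ hy => ⟨hy.1, ?_⟩
    exact lt_of_le_of_lt hy.2 (h.compPos_add_compLen_lt (by omega))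
  · refine hν.block_le h (by omega) measurableSet_Icc fun y _ hy1 hy2 => ⟨hy1, ?_⟩
    rwa [add_sub_cancel_right] at hy2

lemma mass_pos
    (hμ : ∀ w, IsWord n w → 0 < μ {x : cantorSet n c | (x : ℝ) ∈ component n c w})
    {w : List ℕ} (hw : IsWord n w) : 0 < mass μ w :=
  ENNReal.toReal_pos (hμ w hw).ne' (measure_ne_top _ _)

lemma Admissible.cumMass_strict (h : Admissible n c)
    (hμ : ∀ w, IsWord n w → 0 < μ {x : cantorSet n c | (x : ℝ) ∈ component n c w})
    {k : ℕ} {a b : ℤ} (h0 : 0 ≤ a)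
    (h1 : a < numComp n k) (hab : a < b) :
    cumMass n c (lineMeasure μ) k a < cumMass n c (lineMeasure μ) k b := by
  obtain ⟨w, hw, rfl, rfl⟩ := h.exists_word k h0 h1
  have h2 := mass_pos hμ hw
  rw [h.mass_eq hw] at h2
  have h3 := cumMass_mono (ν := lineMeasure μ) h w.length
    (show wordIndex n w + 1 ≤ b by omega)
  linarith

end Measure

end

/-! ### Equivalence of doubling and the ratio conditions -/

section

variable {μ : Measure (cantorSet n c)}

lemma length_ratioVec (w : List ℕ) : (ratioVec μ w).length = n (w.length + 1) := by
  simp [ratioVec]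

lemma IsDoublingMeasure.isDoublingOn (h : Admissible n c) (hd : IsDoublingMeasure μ) :
    ∃ D, 1 ≤ D ∧ IsDoublingOn n c (lineMeasure μ) D := by
  obtain ⟨D, hD1, hD⟩ := hd
  refine ⟨D, by exact_mod_cast hD1, fun x hx r hr => ?_⟩
  rw [← h.cantorSet_eq] at hx
  have h1 := lineMeasure_real_ball (μ := μ) ⟨x, hx⟩ (2 * r)
  have h2 := lineMeasure_real_ball (μ := μ) ⟨x, hx⟩ r
  simp only at h1 h2
  rw [h1, h2]
  obtain ⟨-, h3, h4⟩ := hD ⟨x, hx⟩ r hr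
  have h5 := ENNReal.toReal_mono h4.ne h3
  rwa [ENNReal.toReal_mul, ENNReal.coe_toReal] at h5

variable [IsProbabilityMeasure μ]

/-- The mass to the left of the `a`-th child of the component labelled by `w`. -/
def childCum (μ : Measure (cantorSet n c)) (w : List ℕ) (a : ℕ) : ℝ :=
  cumMass n c (lineMeasure μ) (w.length + 1) (wordIndex n w * n (w.length + 1) + a)

lemma Admissible.getD_ratioVec (h : Admissible n c) {w : List ℕ} (hw : IsWord n w) {a : ℕ}
    (ha : a < n (w.length + 1)) :
    (ratioVec μ w).getD a 0 = 1 / mass μ w * (childCum μ w (a + 1) - childCum μ w a) := by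
  have h1 : IsWord n (w ++ [a + 1]) := isWord_concat.2 ⟨hw, by omega, by omega⟩
  have h2 : (ratioVec μ w).getD a 0 = ratio μ (w ++ [a + 1]) := by
    simp [ratioVec, List.getD_eq_getElem?_getD, ha]
  have h3 : (w ++ [a + 1]).length = w.length + 1 := by simp
  rw [h2, ratio, List.dropLast_concat, h.mass_eq h1, wordIndex_concat, h3]
  unfold childCum
  push_cast
  rw [div_eq_mul_one_div, mul_comm, add_sub_cancel_right, add_assoc]

lemma Admissible.childCum_lt (h : Admissible n c)
    (hμ : ∀ w, IsWord n w → 0 < μ {x : cantorSet n c | (x : ℝ) ∈ component n c w})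
    {w : List ℕ} (hw : IsWord n w) {i l : ℕ} (hl : 1 ≤ l) (hil : i + l ≤ n (w.length + 1)) :
    childCum μ w i < childCum μ w (i + l) := by
  have h1 := (h.child_mem_range (k := w.length) (e := wordIndex n w) (i := i) (by omega)
    (by omega)).2 (h.wordIndex_mem hw)
  exact h.cumMass_strict hμ h1.1 h1.2 (by push_cast; omega)

lemma Admissible.childCum_lt_of_next (h : Admissible n c)
    (hμ : ∀ w, IsWord n w → 0 < μ {x : cantorSet n c | (x : ℝ) ∈ component n c w})
    {w w' : List ℕ} (hw : IsWord n w) (hw' : IsWord n w') (hlen : w'.length = w.length)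
    (hidx : wordIndex n w' = wordIndex n w + 1) {i l : ℕ} (hl : 1 ≤ l)
    (hil : i + l ≤ n (w.length + 1) + n (w.length + 1)) :
    childCum μ w i < childCum μ w (i + l) := by
  have h1 := h.wordIndex_mem hw
  have h2 := h.wordIndex_mem hw'
  rw [hidx, hlen] at h2
  refine h.cumMass_strict hμ ?_ ?_ (by push_cast; omega)
  · have := h1.1
    positivity
  · rw [numComp_succ]
    have h3 : (i : ℤ) < n (w.length + 1) + n (w.length + 1) := by omega
    have h4 := mul_le_mul_of_nonneg_right (show wordIndex n w + 2 ≤ numComp n w.length by omega)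
      (show (0 : ℤ) ≤ n (w.length + 1) by omega)
    linarith

/-- The children of w' continue those of w, so `childCum μ w` measures both halves. Only the
divisors μ(I_w) and μ(I_{w'}) differ, by a factor of at most A. -/
lemma Admissible.getD_ratioVec_append (h : Admissible n c)
    (hμ : ∀ w, IsWord n w → 0 < μ {x : cantorSet n c | (x : ℝ) ∈ component n c w})
    {w w' : List ℕ} (hw : IsWord n w) (hw' : IsWord n w') (hlen : w'.length = w.length)
    (hidx : wordIndex n w' = wordIndex n w + 1) {A : ℝ} (hA : 1 ≤ A)
    (h1 : mass μ w ≤ A * mass μ w') (h2 : mass μ w' ≤ A * mass μ w) {a : ℕ}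
    (ha : a < (ratioVec μ w ++ ratioVec μ w').length) :
    1 / (A * mass μ w) * (childCum μ w (a + 1) - childCum μ w a) ≤
        (ratioVec μ w ++ ratioVec μ w').getD a 0 ∧
      (ratioVec μ w ++ ratioVec μ w').getD a 0 ≤
        A / mass μ w * (childCum μ w (a + 1) - childCum μ w a) := by
  have m1 := mass_pos hμ hw
  have m2 := mass_pos hμ hw'
  rw [List.length_append, length_ratioVec, length_ratioVec, hlen] at ha
  have hpos := h.childCum_lt_of_next hμ hw hw' hlen hidx (i := a) le_rfl (by omega)
  have hpos' := sub_nonneg.2 hpos.le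
  have key : ∀ m, 0 < m → m ≤ A * mass μ w → mass μ w ≤ A * m →
      1 / (A * mass μ w) * (childCum μ w (a + 1) - childCum μ w a) ≤
        1 / m * (childCum μ w (a + 1) - childCum μ w a) ∧
      1 / m * (childCum μ w (a + 1) - childCum μ w a) ≤
        A / mass μ w * (childCum μ w (a + 1) - childCum μ w a) := by
    intro m hm k1 k2
    constructor
    · exact mul_le_mul_of_nonneg_right (one_div_le_one_div_of_le hm k1) hpos'
    · refine mul_le_mul_of_nonneg_right ?_ hpos'
      rw [div_le_div_iff₀ hm m1]
      linarith
  by_cases hlt : a < n (w.length + 1)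
  · rw [List.getD_append _ _ _ _ (by rwa [length_ratioVec]), h.getD_ratioVec hw hlt]
    exact key _ m1 (by nlinarith) (by nlinarith)
  · rw [List.getD_append_right _ _ _ _ (by rw [length_ratioVec]; omega), length_ratioVec,
      h.getD_ratioVec hw' (by rw [hlen]; omega)]
    have e1 : ∀ b : ℕ, n (w.length + 1) ≤ b →
        childCum μ w' (b - n (w.length + 1)) = childCum μ w b := by
      intro b hb
      unfold childCum
      rw [hlen, hidx]
      congr 1
      push_cast [hb]
      ring
    rw [show a - n (w.length + 1) + 1 = a + 1 - n (w.length + 1) by omega, e1 _ (by omega),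
      e1 _ (by omega)]
    exact key _ m2 h2 h1

/-- The quotients telescope; the ratio of v itself does not occur in the product. -/
lemma prod_ratio_maxExt
    (hμ : ∀ w, IsWord n w → 0 < μ {x : cantorSet n c | (x : ℝ) ∈ component n c w})
    (h : Admissible n c) {v : List ℕ} (hv : IsWord n v) (t : ℕ) :
    ∏ j ∈ Finset.Icc 1 t, ratio μ (maxExt n v j) = mass μ (maxExt n v t) / mass μ v := by
  induction t with
  | zero => simp [maxExt_zero, (mass_pos hμ hv).ne']
  | succ t ih =>
    have := (mass_pos hμ (h.isWord_maxExt hv t)).ne'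
    rw [Finset.prod_Icc_succ_top (by omega), ih, ratio]
    conv_lhs => enter [2, 2]; rw [maxExt_succ, List.dropLast_concat]
    rw [mul_comm, div_mul_div_cancel₀ this]

lemma prod_ratio_minExt
    (hμ : ∀ w, IsWord n w → 0 < μ {x : cantorSet n c | (x : ℝ) ∈ component n c w})
    (h : Admissible n c) {v : List ℕ} (hv : IsWord n v) (t : ℕ) :
    ∏ j ∈ Finset.Icc 1 t, ratio μ (minExt v j) = mass μ (minExt v t) / mass μ v := by
  induction t with
  | zero => simp [minExt_zero, (mass_pos hμ hv).ne']
  | succ t ih =>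
    have := (mass_pos hμ (h.isWord_minExt hv t)).ne'
    rw [Finset.prod_Icc_succ_top (by omega), ih, ratio]
    conv_lhs => enter [2, 2]; rw [minExt_succ, List.dropLast_concat]
    rw [mul_comm, div_mul_div_cancel₀ this]

lemma IsDoublingOn.isDoublingMeasure (h : Admissible n c)
    (hμ : ∀ w, IsWord n w → 0 < μ {x : cantorSet n c | (x : ℝ) ∈ component n c w})
    {D : ℝ} (hD1 : 1 ≤ D) (hD : IsDoublingOn n c (lineMeasure μ) D) : IsDoublingMeasure μ := by
  refine ⟨D.toNNReal, by simpa using hD1, fun x r hr => ⟨?_, ?_, ?_⟩⟩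
  · have hx := h.cantorSet_eq.subset x.2
    obtain ⟨k, hk⟩ :=
      (h.compLen_tendsto.eventually_lt_const (show (0 : ℝ) < 2 * r by linarith)).exists
    obtain ⟨a, h0, h1, h2, h3⟩ := hx k
    obtain ⟨w, hw, rfl, rfl⟩ := h.exists_word k h0 h1
    refine (hμ w hw).trans_le (measure_mono fun y hy => ?_)
    rw [mem_ofPred_eq, component, h.leftEnd_eq hw] at hy
    rw [Metric.mem_ball, Subtype.dist_eq, Real.dist_eq, abs_lt]
    constructor <;> linarith [hy.1, hy.2]
  · have h1 := hD x (h.cantorSet_eq.subset x.2) r hr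
    rw [lineMeasure_real_ball, lineMeasure_real_ball] at h1
    have h2 := ENNReal.ofReal_le_ofReal h1
    rwa [ENNReal.ofReal_mul (by linarith), ofReal_measureReal, ofReal_measureReal] at h2
  · exact ENNReal.mul_lt_top ENNReal.coe_lt_top (measure_lt_top _ _)

lemma IsDoublingOn.isUniform_ratioVec (h : Admissible n c)
    (hμ : ∀ w, IsWord n w → 0 < μ {x : cantorSet n c | (x : ℝ) ∈ component n c w})
    {D C : ℝ} (hD1 : 1 ≤ D) (hD : IsDoublingOn n c (lineMeasure μ) D) (hC : D ^ 11 ≤ C)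
    {w : List ℕ} (hw : IsWord n w) : IsUniform C (ratioVec μ w) := by
  have hm := mass_pos hμ hw
  have hA : (1 : ℝ) ≤ D ^ 11 := one_le_pow₀ hD1
  have hr := h.wordIndex_mem hw
  have hν : IsCarried n c (lineMeasure μ) := h.isCarried_lineMeasure
  refine isUniformFrom_of_blocks (G := childCum μ w) (lo := 1 / mass μ w) (hi := 1 / mass μ w)
    (C := D ^ 11) le_rfl (by positivity) (by linarith) (by positivity) (fun a ha => ?_)
    (fun i l hl hil => ?_) (fun i j l hl hij hji hjl => ?_) ?_
  · rw [length_ratioVec] at ha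
    rw [h.getD_ratioVec hw ha]
    exact ⟨le_rfl, le_rfl⟩
  · rw [length_ratioVec] at hil
    exact h.childCum_lt hμ hw hl hil
  · rw [length_ratioVec] at hjl
    unfold childCum
    push_cast
    constructor
    · exact hD.sibling_block_le hD1 hν h hr.1 hr.2 (by omega) (by omega) (by omega) (by omega)
        (by omega) (by omega) (by omega)
    · exact hD.sibling_block_le hD1 hν h hr.1 hr.2 (by omega) (by omega) (by omega) (by omega)
        (by omega) (by omega) (by omega)
  · rw [mul_comm]
    exact mul_le_mul_of_nonneg_right hC (by positivity)

lemma IsDoublingOn.isUniformFrom_append (h : Admissible n c)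
    (hμ : ∀ w, IsWord n w → 0 < μ {x : cantorSet n c | (x : ℝ) ∈ component n c w})
    {D C : ℝ} (hD1 : 1 ≤ D) (hD : IsDoublingOn n c (lineMeasure μ) D) (hC : (D ^ 11) ^ 3 ≤ C)
    {w w' : List ℕ} (hw : IsWord n w) (hw' : IsWord n w') (hlen : w'.length = w.length)
    (hidx : wordIndex n w' = wordIndex n w + 1)
    (h1 : mass μ w ≤ D ^ 11 * mass μ w') (h2 : mass μ w' ≤ D ^ 11 * mass μ w) {s : ℕ}
    (hs : 1 ≤ s) (hgap : gapAfter n c w.length (wordIndex n w) ≤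
      ((s : ℝ) + 1) * step n c (w.length + 1)) :
    IsUniformFrom C s (ratioVec μ w ++ ratioVec μ w') := by
  have hm := mass_pos hμ hw
  have hA : (1 : ℝ) ≤ D ^ 11 := one_le_pow₀ hD1
  have hA3 : (1 : ℝ) ≤ (D ^ 11) ^ 3 := one_le_pow₀ hA
  have hr := h.wordIndex_mem hw
  have hr' := h.wordIndex_mem hw'
  rw [hidx, hlen] at hr'
  have hst := h.step_pos (k := w.length + 1) (by omega)
  have hν : IsCarried n c (lineMeasure μ) := h.isCarried_lineMeasure
  have hlen2 : (ratioVec μ w ++ ratioVec μ w').length =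
      n (w.length + 1) + n (w.length + 1) := by
    rw [List.length_append, length_ratioVec, length_ratioVec, hlen]
  -- Two factors D ^ 11 come from the normalisations and a third from the block comparison, which
  -- explains the cube.
  refine isUniformFrom_of_blocks (G := childCum μ w) (lo := 1 / (D ^ 11 * mass μ w))
    (hi := D ^ 11 / mass μ w) (C := D ^ 11) hs (by positivity) (by linarith) (by positivity)
    (fun a ha => h.getD_ratioVec_append hμ hw hw' hlen hidx hA h1 h2 ha)
    (fun i l hl hil => ?_) (fun i j l hl hij hji hjl => ?_) ?_
  · rw [hlen2] at hil
    exact h.childCum_lt_of_next hμ hw hw' hlen hidx hl hil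
  · rw [hlen2] at hjl
    have hgl : gapAfter n c w.length (wordIndex n w) ≤
        (((l : ℤ) : ℝ) + 1) * step n c (w.length + 1) := by
      refine hgap.trans (mul_le_mul_of_nonneg_right ?_ hst.le)
      have : (s : ℝ) ≤ l := by exact_mod_cast hl
      push_cast
      linarith
    unfold childCum
    push_cast
    constructor
    · exact hD.cousin_block_le hD1 hν h hr.1 hr'.2 (by omega) (by omega) (by omega) (by omega)
        (by omega) (by omega) (by omega) hgl
    · exact hD.cousin_block_le hD1 hν h hr.1 hr'.2 (by omega) (by omega) (by omega) (by omega)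
        (by omega) (by omega) (by omega) hgl
  · rw [div_mul_eq_mul_div, mul_one_div, div_le_div_iff₀ hm (by positivity)]
    have := mul_le_mul_of_nonneg_right hC hm.le
    linarith

lemma IsDoublingOn.mass_comparable (h : Admissible n c) {D : ℝ} (hD1 : 1 ≤ D)
    (hD : IsDoublingOn n c (lineMeasure μ) D)
    {w w' : List ℕ} (hw : IsWord n w) (hw' : IsWord n w') (hlen : w'.length = w.length)
    (hne : w.length ≠ 0) (hidx : wordIndex n w' = wordIndex n w + 1)
    (hgap : gapAfter n c w.length (wordIndex n w) ≤ compLen n c w.length) :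
    mass μ w ≤ D ^ 11 * mass μ w' ∧ mass μ w' ≤ D ^ 11 * mass μ w := by
  have hν : IsCarried n c (lineMeasure μ) := h.isCarried_lineMeasure
  have hr := h.wordIndex_mem hw
  have hr' := h.wordIndex_mem hw'
  rw [h.mass_eq hw, h.mass_eq hw', hidx, hlen, show wordIndex n w + 1 + 1 = wordIndex n w + 2 by
    ring]
  rw [hidx, hlen] at hr'
  obtain ⟨k, hk⟩ := Nat.exists_eq_succ_of_ne_zero hne
  rw [Nat.succ_eq_add_one] at hk
  rw [hk] at hgap hr' ⊢
  have := hD.neighbour_le hD1 hν h hr.1 hr'.2 hgap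
  exact ⟨this.2, this.1⟩

/-- The condition on the ratios of `μ` in terms of words. -/
def RatioCondition (n : ℕ → ℕ) (c : ℕ → ℝ) (μ : Measure (cantorSet n c)) (C : ℝ) : Prop :=
  (∀ w : List ℕ, IsWord n w → IsUniform C (ratioVec μ w)) ∧
    ∀ k ∈ shortGapLevels n c, ∀ w : List ℕ, IsWord n w → w.length = k - 1 →
      ∀ i : ℕ, 1 ≤ i → i < n k →
        (∀ t : ℕ, 1 ≤ t → t < gapDepth n c k →
          IsUniform C (ratioVec μ (maxExt n (w ++ [i]) (t - 1)) ++
            ratioVec μ (minExt (w ++ [i + 1]) (t - 1))) ∧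
          C⁻¹ * ∏ j ∈ Finset.Icc 1 t, ratio μ (maxExt n (w ++ [i]) j)
            ≤ ∏ j ∈ Finset.Icc 1 t, ratio μ (minExt (w ++ [i + 1]) j) ∧
          ∏ j ∈ Finset.Icc 1 t, ratio μ (minExt (w ++ [i + 1]) j)
            ≤ C * ∏ j ∈ Finset.Icc 1 t, ratio μ (maxExt n (w ++ [i]) j)) ∧
        IsUniformFrom C (gapCount n c k)
          (ratioVec μ (maxExt n (w ++ [i]) (gapDepth n c k - 1)) ++
            ratioVec μ (minExt (w ++ [i + 1]) (gapDepth n c k - 1)))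

lemma IsDoublingOn.ratioCondition (h : Admissible n c)
    (hμ : ∀ w, IsWord n w → 0 < μ {x : cantorSet n c | (x : ℝ) ∈ component n c w})
    {D C : ℝ} (hD1 : 1 ≤ D) (hD : IsDoublingOn n c (lineMeasure μ) D) (hC : (D ^ 11) ^ 3 ≤ C) :
    RatioCondition n c μ C := by
  have hA : (1 : ℝ) ≤ D ^ 11 := one_le_pow₀ hD1
  have hA1 : D ^ 11 ≤ (D ^ 11) ^ 3 := le_self_pow₀ hA (by norm_num)
  have hA2 : (D ^ 11) ^ 2 ≤ (D ^ 11) ^ 3 := pow_le_pow_right₀ hA (by norm_num)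
  refine ⟨fun w hw => hD.isUniform_ratioVec h hμ hD1 (by linarith) hw, ?_⟩
  intro k hk w hw hwk i hi hin
  have hk1 := hk.1
  obtain rfl : k = w.length + 1 := by omega
  obtain ⟨hm1, hm2, hm3⟩ := (existsUnique_isGapDepth h.two_le h.c_mem h.lt_one hk).2
  obtain ⟨hs1, hs2, hs3⟩ := (existsUnique_isGapCount h.two_le h.c_mem h.lt_one hk).2
  have hwi : IsWord n (w ++ [i]) := isWord_concat.2 ⟨hw, hi, hin.le⟩
  have hwi' : IsWord n (w ++ [i + 1]) := isWord_concat.2 ⟨hw, by omega, by omega⟩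
  have hlen : ∀ t, (maxExt n (w ++ [i]) t).length = w.length + 1 + t := fun t => by
    rw [length_maxExt, List.length_append, List.length_singleton]
  have hlen' : ∀ t, (minExt (w ++ [i + 1]) t).length = (maxExt n (w ++ [i]) t).length :=
    fun t => by rw [hlen, length_minExt, List.length_append, List.length_singleton]
  have hmass : ∀ t, t < gapDepth n c (w.length + 1) →
      mass μ (maxExt n (w ++ [i]) t) ≤ D ^ 11 * mass μ (minExt (w ++ [i + 1]) t) ∧
        mass μ (minExt (w ++ [i + 1]) t) ≤ D ^ 11 * mass μ (maxExt n (w ++ [i]) t) := by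
    intro t ht
    refine hD.mass_comparable h hD1 (h.isWord_maxExt hwi t) (h.isWord_minExt hwi' t) (hlen' t)
      (by rw [hlen]; omega) (wordIndex_minExt w i t) ?_
    rw [hlen, h.gapAfter_maxExt w hi hin]
    refine hm3.le.trans (h.compLen_anti.antitone ?_)
    omega
  have hunif : ∀ t s : ℕ, t < gapDepth n c (w.length + 1) → 1 ≤ s →
      gapLen n c (w.length + 1) ≤ ((s : ℝ) + 1) * step n c (w.length + 1 + t + 1) →
      IsUniformFrom C s (ratioVec μ (maxExt n (w ++ [i]) t) ++
        ratioVec μ (minExt (w ++ [i + 1]) t)) := by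
    intro t s ht hs hg
    refine hD.isUniformFrom_append h hμ hD1 hC (h.isWord_maxExt hwi t) (h.isWord_minExt hwi' t)
      (hlen' t) (wordIndex_minExt w i t) (hmass t ht).1 (hmass t ht).2 hs ?_
    rwa [hlen, h.gapAfter_maxExt w hi hin]
  refine ⟨fun t ht1 ht2 => ⟨?_, ?_⟩, ?_⟩
  -- For t < m_k a single component of level k + t is longer than ε_k, so blocks of length 1 are
  -- long enough.
  · refine hunif (t - 1) 1 (by omega) le_rfl ?_
    have h1 : gapLen n c (w.length + 1) ≤ compLen n c (w.length + 1 + (t - 1) + 1) :=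
      hm3.le.trans (h.compLen_anti.antitone (by omega))
    have h2 := h.compLen_lt_step (w.length + 1 + (t - 1))
    have h3 := h.compLen_pos (w.length + 1 + (t - 1) + 1)
    push_cast
    linarith
  -- The products are masses at level k + t divided by masses at level k, and neighbours are
  -- comparable at both levels.
  · rw [prod_ratio_maxExt hμ h hwi, prod_ratio_minExt hμ h hwi']
    have h0 := hmass 0 (by omega)
    have h1 := hmass t ht2
    rw [maxExt_zero, minExt_zero] at h0
    have p1 := mass_pos hμ hwi
    have p2 := mass_pos hμ hwi'
    have p3 := mass_pos hμ (h.isWord_maxExt hwi t)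
    have p4 := mass_pos hμ (h.isWord_minExt hwi' t)
    have key : ∀ {x y x' y' : ℝ}, 0 < x → 0 < y → 0 < x' → 0 < y' → x ≤ D ^ 11 * y →
        y' ≤ D ^ 11 * x' → x / x' ≤ C * (y / y') := by
      intro x y x' y' hx hy hx' hy' hxy hyx
      rw [mul_div_assoc', div_le_div_iff₀ hx' hy']
      have e1 := mul_le_mul hxy hyx hy'.le (by positivity)
      have e2 := mul_le_mul_of_nonneg_right (hA2.trans hC) (mul_pos hy hx').le
      linarith
    constructor
    · rw [inv_mul_le_iff₀ (by linarith)]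
      exact key p3 p4 p1 p2 h1.1 h0.2
    · exact key p4 p3 p2 p1 h1.2 h0.1
  -- The upper inequality for s_k says that ε_k is less than s_k + 1 steps of level k + m_k.
  · refine hunif _ _ (by omega) hs1 ?_
    rw [show w.length + 1 + (gapDepth n c (w.length + 1) - 1) + 1 =
      w.length + 1 + gapDepth n c (w.length + 1) by omega]
    have h3 := h.gapLen_pos (k := w.length + 1 + gapDepth n c (w.length + 1)) (by omega)
    unfold step
    linarith

lemma RatioCondition.isBlockUniform (h : Admissible n c)
    (hμ : ∀ w, IsWord n w → 0 < μ {x : cantorSet n c | (x : ℝ) ∈ component n c w})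
    {C : ℝ} (hC : 1 < C) (hR : RatioCondition n c μ C) {w : List ℕ} (hw : IsWord n w) :
    IsBlockUniform (fun i => cumMass n c (lineMeasure μ) (w.length + 1)
      (wordIndex n w * n (w.length + 1) + i)) C (n (w.length + 1)) := by
  intro i j l hl hi hij hji hjl
  have hm := mass_pos hμ hw
  lift i to ℕ using hi
  lift l to ℕ using by omega
  lift j to ℕ using by omega
  have := blocks_of_isUniformFrom (P := ratioVec μ w) (G := childCum μ w) (lo := 1 / mass μ w)
    (hi := 1 / mass μ w) (C := C) (C' := C) (s := 1) (i := i) (j := j) (l := l) le_rfl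
    (by positivity) (by linarith) (fun a ha => by
      rw [length_ratioVec] at ha
      rw [h.getD_ratioVec hw ha]
      exact ⟨le_rfl, le_rfl⟩)
    (fun i l hl hil => by
      rw [length_ratioVec] at hil
      exact h.childCum_lt hμ hw hl hil) (hR.1 w hw) le_rfl (by omega) (by omega) (by omega)
      (by rw [length_ratioVec]; omega)
  unfold childCum at this
  push_cast at this
  exact this

lemma RatioCondition.isBalanced (h : Admissible n c)
    (hμ : ∀ w, IsWord n w → 0 < μ {x : cantorSet n c | (x : ℝ) ∈ component n c w})
    {C : ℝ} (hC : 1 < C) (hR : RatioCondition n c μ C) :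
    IsBalanced n c (lineMeasure μ) (C ^ 5) := by
  have hC5 : C ≤ C ^ 5 := le_self_pow₀ hC.le (by norm_num)
  constructor
  · intro k e he0 he1
    obtain ⟨w, hw, rfl, rfl⟩ := h.exists_word k he0 he1
    intro i j l hl hi hij hji hjl
    have h1 := hR.isBlockUniform h hμ hC hw i j l hl hi hij hji hjl
    have m : ∀ {a b : ℤ}, a ≤ b → 0 ≤ cumMass n c (lineMeasure μ) (w.length + 1) b -
        cumMass n c (lineMeasure μ) (w.length + 1) a := fun hab =>
      sub_nonneg.2 (cumMass_mono h _ hab)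
    exact ⟨h1.1.trans (mul_le_mul_of_nonneg_right hC5 (m (by omega))),
      h1.2.trans (mul_le_mul_of_nonneg_right hC5 (m (by omega)))⟩
  · intro K e l he0 he1 hgδ hl hln hgl
    lift l to ℕ using by omega
    obtain ⟨w, i, t, hw, hi, hin, rfl, rfl⟩ := h.exists_maxExt K he0 he1
    rw [h.gapAfter_maxExt w hi hin] at hgδ hgl
    have hk : w.length + 1 ∈ shortGapLevels n c :=
      ⟨by omega, hgδ.trans_le (h.compLen_anti.antitone (by omega))⟩
    obtain ⟨hm1, hm2, hm3⟩ := (existsUnique_isGapDepth h.two_le h.c_mem h.lt_one hk).2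
    obtain ⟨hs1, hs2, hs3⟩ := (existsUnique_isGapCount h.two_le h.c_mem h.lt_one hk).2
    -- The gap is shorter than the parents, δ_{k+m_k} ≤ ε_k < δ_{k+t}, so only levels covered by (a)
    -- or (b) occur.
    have htm : t < gapDepth n c (w.length + 1) := by
      have := h.compLen_anti.lt_iff_gt.1 (hm2.trans_lt hgδ)
      omega
    have hwi : IsWord n (w ++ [i]) := isWord_concat.2 ⟨hw, hi, hin.le⟩
    have hwi' : IsWord n (w ++ [i + 1]) := isWord_concat.2 ⟨hw, by omega, by omega⟩
    obtain ⟨hR1, hR2⟩ := hR.2 (w.length + 1) hk w hw (by omega) i hi hin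
    have p1 := mass_pos hμ hwi
    have p2 := mass_pos hμ hwi'
    have h0 : mass μ (w ++ [i]) ≤ C * mass μ (w ++ [i + 1]) ∧
        mass μ (w ++ [i + 1]) ≤ C * mass μ (w ++ [i]) := by
      have := hR.isBlockUniform h hμ hC hw (i - 1) i 1 le_rfl (by omega) (by omega) (by omega)
        (by omega)
      rw [h.mass_eq hwi, h.mass_eq hwi', wordIndex_concat, wordIndex_concat]
      simp only [List.length_append, List.length_singleton]
      push_cast
      simp only [add_assoc, sub_add_cancel, add_sub_cancel_right] at this ⊢
      exact this
    -- The products in (a) omit the ratios of wi and w(i+1); uniformity of P_w compares these,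
    -- whence the second factor C.
    have hmass : mass μ (maxExt n (w ++ [i]) t) ≤ C ^ 2 * mass μ (minExt (w ++ [i + 1]) t) ∧
        mass μ (minExt (w ++ [i + 1]) t) ≤ C ^ 2 * mass μ (maxExt n (w ++ [i]) t) := by
      have hC2 : C ≤ C ^ 2 := le_self_pow₀ hC.le (by norm_num)
      rcases Nat.eq_zero_or_pos t with rfl | ht
      · rw [maxExt_zero, minExt_zero]
        exact ⟨h0.1.trans (mul_le_mul_of_nonneg_right hC2 p2.le),
          h0.2.trans (mul_le_mul_of_nonneg_right hC2 p1.le)⟩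
      · obtain ⟨-, q1, q2⟩ := hR1 t ht htm
        rw [prod_ratio_maxExt hμ h hwi, prod_ratio_minExt hμ h hwi'] at q1 q2
        rw [inv_mul_le_iff₀ (by linarith)] at q1
        have p3 := mass_pos hμ (h.isWord_maxExt hwi t)
        have p4 := mass_pos hμ (h.isWord_minExt hwi' t)
        have key : ∀ {x y x' y' : ℝ}, 0 < y → 0 < x' → 0 < y' → x' ≤ C * y' →
            x / x' ≤ C * (y / y') → x ≤ C ^ 2 * y := by
          intro x y x' y' hy hx' hy' hxy hq
          rw [mul_div_assoc', div_le_div_iff₀ hx' hy'] at hq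
          have e1 := mul_le_mul_of_nonneg_left hxy (mul_pos (by linarith : 0 < C) hy).le
          refine le_of_mul_le_mul_right (hq.trans (e1.trans (le_of_eq ?_))) hy'
          ring
        exact ⟨key p4 p1 p2 h0.1 q1, key p3 p2 p1 h0.2 q2⟩
    -- The children have level k + t + 1, so (a) is used for t + 1, or (b) if t + 1 = m_k. In the
    -- latter case the lower inequality for s_k and the bound on the gap give (s_k - 1) steps < l
    -- steps, so s_k ≤ l.
    obtain ⟨s, hs, hsl, hU⟩ : ∃ s, 1 ≤ s ∧ s ≤ l ∧
        IsUniformFrom C s (ratioVec μ (maxExt n (w ++ [i]) t) ++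
          ratioVec μ (minExt (w ++ [i + 1]) t)) := by
      by_cases ht : t + 1 < gapDepth n c (w.length + 1)
      · exact ⟨1, le_rfl, by omega, (hR1 (t + 1) (by omega) ht).1⟩
      · have htm' : gapDepth n c (w.length + 1) = t + 1 := by omega
        rw [htm', add_tsub_cancel_right] at hR2
        refine ⟨_, hs1, ?_, hR2⟩
        rw [htm', ← add_assoc] at hs2
        have hst := h.step_pos (k := w.length + 1 + t + 1) (by omega)
        have h1 : ((gapCount n c (w.length + 1) : ℝ) - 1) * step n c (w.length + 1 + t + 1) <
            l * step n c (w.length + 1 + t + 1) := by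
          unfold step at hgl ⊢
          push_cast at hgl
          linarith
        have h2 := lt_of_mul_lt_mul_right h1 hst.le
        have h3 : (gapCount n c (w.length + 1) : ℝ) < l + 1 := by linarith
        have h4 : gapCount n c (w.length + 1) < l + 1 := by exact_mod_cast h3
        omega
    have hlen : (maxExt n (w ++ [i]) t).length = w.length + 1 + t := by
      rw [length_maxExt, List.length_append, List.length_singleton]
    have hlen' : (minExt (w ++ [i + 1]) t).length = (maxExt n (w ++ [i]) t).length := by
      rw [hlen, length_minExt, List.length_append, List.length_singleton]
    have hv := h.isWord_maxExt hwi t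
    have hv' := h.isWord_minExt hwi' t
    have hidx := wordIndex_minExt (n := n) w i t
    generalize maxExt n (w ++ [i]) t = v at *
    generalize minExt (w ++ [i + 1]) t = v' at *
    have hlen2 : (ratioVec μ v ++ ratioVec μ v').length =
        n (v.length + 1) + n (v.length + 1) := by
      rw [List.length_append, length_ratioVec, length_ratioVec, hlen']
    have pv := mass_pos hμ hv
    rw [← hlen] at hln ⊢
    have hln' : l ≤ n (v.length + 1) := by exact_mod_cast hln
    -- The two blocks meet at the junction of the concatenated vector: the last l children of v and
    -- the first l of v'. The constant is C times `hi / lo` = C ^ 4.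
    have := blocks_of_isUniformFrom (P := ratioVec μ v ++ ratioVec μ v') (G := childCum μ v)
      (lo := 1 / (C ^ 2 * mass μ v)) (hi := C ^ 2 / mass μ v) (C := C) (C' := C ^ 5) (s := s)
      (i := n (v.length + 1) - l) (j := n (v.length + 1)) (l := l) hs
      (by positivity) (by linarith)
      (fun a ha => h.getD_ratioVec_append hμ hv hv' hlen' hidx (one_le_pow₀ hC.le) hmass.1
        hmass.2 ha)
      (fun i l hl hil => by
        rw [hlen2] at hil
        exact h.childCum_lt_of_next hμ hv hv' hlen' hidx hl hil) hU
      (by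
        refine le_of_eq ?_
        field_simp) hsl (by omega) (by omega) (by omega)
    rw [Nat.sub_add_cancel hln'] at this
    unfold childCum at this
    push_cast [hln'] at this
    rw [show wordIndex n v * (n (v.length + 1) : ℤ) + n (v.length + 1) =
        (wordIndex n v + 1) * n (v.length + 1) by ring,
      show wordIndex n v * (n (v.length + 1) : ℤ) + (n (v.length + 1) - l) =
        (wordIndex n v + 1) * n (v.length + 1) - l by ring,
      show wordIndex n v * (n (v.length + 1) : ℤ) + (n (v.length + 1) + l) =
        (wordIndex n v + 1) * n (v.length + 1) + l by ring, cumMass_mul h] at this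
    exact this

end

end UniformCantor

end

theorem theorem2 (n : ℕ → ℕ) (c : ℕ → ℝ)
    (hn : ∀ k, 1 ≤ k → 2 ≤ n k)
    (hc : ∀ k, 1 ≤ k → 0 < c k ∧ c k < 1)
    (hnc : ∀ k, 1 ≤ k → ((n k : ℝ) - 1) * c k < 1)
    (μ : MeasureTheory.Measure (UniformCantor.cantorSet n c))
    [MeasureTheory.IsProbabilityMeasure μ]
    (hμ : ∀ w : List ℕ, UniformCantor.IsWord n w →
      0 < μ {x : UniformCantor.cantorSet n c | (x : ℝ) ∈ UniformCantor.component n c w}) :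
    IsDoublingMeasure μ ↔
      ∃ C : ℝ, 1 < C ∧
        (∀ w : List ℕ, UniformCantor.IsWord n w → IsUniform C (UniformCantor.ratioVec μ w)) ∧
        ∀ k ∈ UniformCantor.shortGapLevels n c,
          ∀ w : List ℕ, UniformCantor.IsWord n w → w.length = k - 1 →
          ∀ i : ℕ, 1 ≤ i → i < n k →
            (∀ t : ℕ, 1 ≤ t → t < UniformCantor.gapDepth n c k →
              IsUniform C
                (UniformCantor.ratioVec μ (UniformCantor.maxExt n (w ++ [i]) (t - 1)) ++
                  UniformCantor.ratioVec μ (UniformCantor.minExt (w ++ [i + 1]) (t - 1))) ∧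
              C⁻¹ * ∏ j ∈ Finset.Icc 1 t,
                  UniformCantor.ratio μ (UniformCantor.maxExt n (w ++ [i]) j)
                ≤ ∏ j ∈ Finset.Icc 1 t,
                  UniformCantor.ratio μ (UniformCantor.minExt (w ++ [i + 1]) j) ∧
              ∏ j ∈ Finset.Icc 1 t,
                  UniformCantor.ratio μ (UniformCantor.minExt (w ++ [i + 1]) j)
                ≤ C * ∏ j ∈ Finset.Icc 1 t,
                  UniformCantor.ratio μ (UniformCantor.maxExt n (w ++ [i]) j)) ∧
            IsUniformFrom C (UniformCantor.gapCount n c k)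
              (UniformCantor.ratioVec μ
                  (UniformCantor.maxExt n (w ++ [i]) (UniformCantor.gapDepth n c k - 1)) ++
                UniformCantor.ratioVec μ
                  (UniformCantor.minExt (w ++ [i + 1]) (UniformCantor.gapDepth n c k - 1))) := by
  have h : UniformCantor.Admissible n c := ⟨hn, hc, hnc⟩
  constructor
  · intro hd
    obtain ⟨D, hD1, hD⟩ := UniformCantor.IsDoublingMeasure.isDoublingOn h hd
    -- The summand 1 makes the constant strictly larger than 1, even when D = 1.
    refine ⟨(D ^ 11) ^ 3 + 1, ?_, hD.ratioCondition h hμ hD1 (by linarith)⟩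
    have : 0 < (D ^ 11) ^ 3 := by positivity
    linarith
  · rintro ⟨C, hC, hR⟩
    have hC5 : 0 ≤ C ^ 5 := by positivity
    have hR' : UniformCantor.RatioCondition n c μ C := hR
    refine UniformCantor.IsDoublingOn.isDoublingMeasure h hμ ?_
      ((hR'.isBalanced h hμ hC).isDoublingOn hC5 h.isCarried_lineMeasure h)
    have : (1 : ℝ) ≤ (1 + C ^ 5) ^ 8 := one_le_pow₀ (by linarith)
    linarith
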